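/- Let $n\ge 0$ be an integer. Write $\mathcal H^n$ for the $n$-dimensional Hausdorff measure, normalized so that $\mathcal H^n$ on $\mathbb R^n$ is Lebesgue measure. A metric space $X$ is called $n$-rectifiable if there are countably many Borel sets $E_i\subset\mathbb R^n$ and Lipschitz maps $g_i:E_i\to X$ with $\mathcal H^n\bigl(X\setminus\bigcup_i g_i(E_i)\bigr)=0$. A Borel map $f:X\to Y$ between $n$-rectifiable metric spaces is volume preserving if $f_*\mathcal H^n_X=\mathcal H^n_Y$. Curves are continuous maps $\gamma:[0,1]\to X$, and $\ell(\gamma)\in[0,\infty]$ denotes the length of $\gamma$. For a Borel function $\rho:X\to[0,\infty]$ put $\int_\gamma\rho=\int_0^{\ell(\gamma)}\rho(\gamma_s(t))\,dt$, where $\gamma_s$ is the arc length parametrization of $\gamma$, if $\ell(\gamma)<\infty$, and $\int_\gamma\rho=\infty$ otherwise. The $\infty$-modulus of a family $\Gamma$ of curves is $$\operatorname{Mod}_\infty(\Gamma)=\inf\Bigl\{\|\rho\|_{L^\infty(X,\mathcal H^n)}:\ \rho:X\to[0,\infty]\text{ Borel},\ \int_\gamma\rho\ge 1\text{ for every }\gamma\in\Gamma\Bigr\},$$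 and a property holds for $\infty$-almost every curve if the family of curves for which it fails has $\infty$-modulus zero. Let $X$ and $Y$ be $n$-rectifiable metric spaces and let $f:X\to Y$ be a $1$-Lipschitz map. 1. If $f$ is volume preserving, then there is a Borel set $N\subset X$ with $\mathcal H^n(N)=0$ such that for every absolutely continuous curve $\gamma:[0,1]\to X$ for which $\gamma^{-1}(N)$ has Lebesgue measure zero, $$\ell(\gamma)=\ell(f\circ\gamma).$$ 2. If $f$ is surjective and $\mathcal H^n(X)=\mathcal H^n(Y)<\infty$, then $f$ is volume preserving, and $\ell(f\circ\gamma)=\ell(\gamma)$ for $\infty$-almost every curve $\gamma$ in $X$. -/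

import Mathlib

open Set MeasureTheory
open scoped ENNReal NNReal

namespace VolumeRigidity

/-- A metric space `X` is `n`-rectifiable if, up to an `ℋⁿ`-null set, it is covered by countably many
Lipschitz images of Borel subsets of `ℝⁿ` (some or all of which may be empty). -/
def IsRectifiableSpace (n : ℕ) (X : Type*) [MetricSpace X] [MeasurableSpace X] [BorelSpace X] :
    Prop :=
  ∃ (E : ℕ → Set (EuclideanSpace ℝ (Fin n))) (g : ∀ i, E i → X),
    (∀ i, MeasurableSet (E i)) ∧ (∀ i, ∃ L : ℝ≥0, LipschitzWith L (g i)) ∧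
      (μHE[n] : Measure X) (⋃ i, range (g i))ᶜ = 0

/-- The length of the curve `γ|[0,1]`. Curves are parametrized on `[0,1]`; the values of `γ` outside
`[0,1]` are irrelevant. -/
noncomputable def curveLength {X : Type*} [MetricSpace X] (γ : ℝ → X) : ℝ≥0∞ :=
  eVariationOn γ (Icc 0 1)

open Classical in
/-- The line integral of `ρ` over the curve `γ|[0,1]`: the integral over `[0, ℓ(γ)]` of `ρ` along the
arc length parametrization if `γ` is rectifiable, and `∞` otherwise. -/
noncomputable def lineIntegral {X : Type*} [MetricSpace X] (ρ : X → ℝ≥0∞) (γ : ℝ → X) : ℝ≥0∞ :=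
  if curveLength γ = ∞ then ∞
  else ∫⁻ s in Icc 0 (curveLength γ).toReal, ρ (naturalParameterization γ (Icc 0 1) 0 s)

/-- The `∞`-modulus of a family `Γ` of curves with respect to `μ`: the infimum of the `L^∞`-norms of
the Borel functions `ρ : X → [0,∞]` whose line integral over every curve of `Γ` is at least `1`. -/
noncomputable def modulusTop {X : Type*} [MetricSpace X] [MeasurableSpace X] (μ : Measure X)
    (Γ : Set (ℝ → X)) : ℝ≥0∞ :=
  ⨅ (ρ : X → ℝ≥0∞) (_ : Measurable ρ) (_ : ∀ γ ∈ Γ, 1 ≤ lineIntegral ρ γ), essSup ρ μ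

/-- The property `P` holds for `∞`-almost every curve `γ : [0,1] → X`. -/
def ForTopAlmostEveryCurve {X : Type*} [MetricSpace X] [MeasurableSpace X] (μ : Measure X)
    (P : (ℝ → X) → Prop) : Prop :=
  modulusTop μ {γ | ContinuousOn γ (Icc 0 1) ∧ ¬ P γ} = 0

end VolumeRigidity

namespace VolumeRigidity
open Filter Topology Pointwise Metric

/-! ### The isodiametric inequality for seminorms -/

/-! A Lipschitz chart `g` of `X` is metrically differentiable almost everywhere: near `x`, distances
between `g y` and `g x` are given to first order by a seminorm `S x`, and those of `f ∘ g` by a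
seminorm `S' x`, which may be taken `≤ S x` because `f` is 1-Lipschitz. Where `S x` is degenerate,
the image in `X` is null. Where `S x` is a norm and `S' x ≠ S x`, the unit ball of `S' x` has
strictly larger volume, so `f` strictly decreases Hausdorff measure there; a volume preserving `f`
allows this only on a null set. Hence, off a null set `N`, `X` is covered by countably many sets
along which `f` is isometric to first order (`exists_null_isFirstOrderIsometryOn`).

The measure comparison rests on two estimates relating Hausdorff measure of images to volumes of
seminorm unit balls: an upper one by Vitali covering (`mul_hausdorffMeasure_image_le`) and a lower
one by the isodiametric inequality (`volume_le_mul_hausdorffMeasure_image`), the latter derived from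
Prékopa–Leindler. All sets are treated by outer measure, so no measurable selection of seminorms is
required.

For an absolutely continuous curve that avoids `N` at almost every time, first order isometry bounds
the derivative of `dist (γ t) x` by that of the length function of `f ∘ γ`; integrating gives `ℓ(γ)
≤ ℓ(f ∘ γ)` (`eVariationOn_le_eVariationOn_comp`). In the second part, surjectivity and equality of
finite masses force volume preservation, and the density `∞ · 1_N` shows that the curves spending
positive arc length in `N` are negligible. -/

theorem volume_add_volume_le_volume_add {K L : Set ℝ} (hK : IsCompact K) (hL : IsCompact L)
    (hKn : K.Nonempty) (hLn : L.Nonempty) : volume K + volume L ≤ volume (K + L) := by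
  obtain ⟨a, haK, ha⟩ := hK.exists_isGreatest hKn
  obtain ⟨b, hbL, hb⟩ := hL.exists_isLeast hLn
  have h1 : volume K = volume (K + {b}) := by simp
  have h2 : volume L = volume ({a} + L) := by simp
  have hm : MeasurableSet ({a} + L) := (isCompact_singleton.add hL).measurableSet
  -- Since `a` is the greatest point of `K` and `b` the least of `L`, the first translate lies to
  -- the left of `a + b` and the second to its right.
  have hd : AEDisjoint volume (K + {b}) ({a} + L) := by
    refine measure_mono_null (t := {a + b}) ?_ (by simp)
    rintro z ⟨⟨x, hx, y, rfl, rfl⟩, ⟨x', rfl, y', hy', h⟩⟩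
    have := ha hx
    have := hb hy'
    simp only [mem_singleton_iff] at h ⊢
    linarith
  rw [h1, h2, ← measure_union₀ hm.nullMeasurableSet hd]
  refine measure_mono (union_subset ?_ ?_)
  · exact add_subset_add_left (by simpa using hbL)
  · exact add_subset_add_right (by simpa using haK)

theorem volume_add_volume_le_two_mul {A B S : Set ℝ} (hA : MeasurableSet A) (hB : MeasurableSet B)
    (hAn : A.Nonempty) (hBn : B.Nonempty)
    (h : ∀ x ∈ A, ∀ y ∈ B, (2 : ℝ)⁻¹ * (x + y) ∈ S) : volume A + volume B ≤ 2 * volume S := by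
  obtain ⟨a, ha⟩ := hAn
  obtain ⟨b, hb⟩ := hBn
  have key : ∀ K ⊆ A, IsCompact K → ∀ L ⊆ B, IsCompact L → volume K + volume L ≤ 2 * volume S := by
    intro K hKA hK L hLB hL
    -- Adding the points `a` and `b` keeps the compact sets nonempty without leaving `A` and `B`.
    have h0 := volume_add_volume_le_volume_add (hK.insert a) (hL.insert b)
      (insert_nonempty _ _) (insert_nonempty _ _)
    calc volume K + volume L ≤ volume (insert a K) + volume (insert b L) :=
          add_le_add (measure_mono (subset_insert _ _)) (measure_mono (subset_insert _ _))
      _ ≤ _ := h0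
      _ ≤ volume ((2 : ℝ) • S) := by
          refine measure_mono ?_
          rintro z ⟨x, hx, y, hy, rfl⟩
          refine ⟨(2 : ℝ)⁻¹ * (x + y), h x (insert_subset ha hKA hx) y (insert_subset hb hLB hy), ?_⟩
          simp
      _ = 2 * volume S := by
          rw [Measure.addHaar_smul]; simp
  rw [hA.measure_eq_iSup_isCompact, hB.measure_eq_iSup_isCompact]
  simp only [iSup_and']
  exact ENNReal.biSup_add_biSup_le' ⟨∅, empty_subset _, isCompact_empty⟩
    ⟨∅, empty_subset _, isCompact_empty⟩ fun K hK L hL => key K hK.1 hK.2 L hL.1 hL.2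

theorem lintegral_eq_lintegral_volume_ofReal_lt {f : ℝ → ℝ≥0∞} (hf : Measurable f) :
    ∫⁻ x, f x = ∫⁻ t in Ioi (0 : ℝ), volume {x | ENNReal.ofReal t < f x} := by
  have hS : MeasurableSet {p : ℝ × ℝ | ENNReal.ofReal p.2 < f p.1} :=
    measurableSet_lt (by fun_prop) (by fun_prop)
  have h1 : ∀ a : ℝ≥0∞, a = ∫⁻ t in Ioi (0 : ℝ),
      {t : ℝ | ENNReal.ofReal t < a}.indicator 1 t := by
    intro a
    rw [lintegral_indicator_one (measurableSet_lt (by fun_prop) (by fun_prop)),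
      Measure.restrict_apply (measurableSet_lt (by fun_prop) (by fun_prop))]
    induction a using ENNReal.recTopCoe with
    | top => simp
    | coe a =>
      have : {t : ℝ | ENNReal.ofReal t < a} ∩ Ioi 0 = Ioo 0 (a : ℝ) := by
        ext t
        simp only [mem_inter_iff, mem_ofPred_eq, mem_Ioi, mem_Ioo]
        constructor
        · rintro ⟨h, h0⟩
          exact ⟨h0, by rwa [ENNReal.ofReal_lt_coe_iff h0.le] at h⟩
        · rintro ⟨h0, h⟩
          exact ⟨by rwa [ENNReal.ofReal_lt_coe_iff h0.le], h0⟩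
      simp [this]
  calc ∫⁻ x, f x = ∫⁻ x, ∫⁻ t in Ioi (0 : ℝ), {t : ℝ | ENNReal.ofReal t < f x}.indicator 1 t :=
        lintegral_congr fun x => h1 (f x)
    _ = ∫⁻ t in Ioi (0 : ℝ), ∫⁻ x, {t : ℝ | ENNReal.ofReal t < f x}.indicator 1 t := by
        refine lintegral_lintegral_swap ?_
        exact (measurable_one.indicator hS).aemeasurable
    _ = _ := by
        refine lintegral_congr fun t => ?_
        rw [← lintegral_indicator_one (measurableSet_lt measurable_const hf)]
        rfl

theorem four_mul_le_add_sq (x y : ℝ≥0∞) : 4 * (x * y) ≤ (x + y) ^ 2 := by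
  induction x using ENNReal.recTopCoe with
  | top => simp
  | coe x =>
    induction y using ENNReal.recTopCoe with
    | top => simp
    | coe y =>
      norm_cast
      rw [← NNReal.coe_le_coe]
      push_cast
      nlinarith [sq_nonneg ((x : ℝ) - y)]

/-- With both suprema equal to 1, the superlevel sets of `f` and `g` are nonempty at every level `t
< 1` and empty from 1 on. One-dimensional Brunn–Minkowski therefore applies level by level, and the
layer-cake formula sums up. -/
theorem lintegral_add_lintegral_le_of_iSup_eq_one {f g h : ℝ → ℝ≥0∞} (hf : Measurable f)
    (hg : Measurable g) (hh : Measurable h) (hf1 : ⨆ x, f x = 1) (hg1 : ⨆ x, g x = 1)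
    (H : ∀ x y, f x * g y ≤ h ((2 : ℝ)⁻¹ * (x + y)) ^ 2) :
    (∫⁻ x, f x) + ∫⁻ x, g x ≤ 2 * ∫⁻ x, h x := by
  rw [lintegral_eq_lintegral_volume_ofReal_lt hf, lintegral_eq_lintegral_volume_ofReal_lt hg,
    lintegral_eq_lintegral_volume_ofReal_lt hh, ← lintegral_const_mul' _ _ (by simp)]
  have hm : Measurable fun t : ℝ => volume {x | ENNReal.ofReal t < f x} :=
    Antitone.measurable fun s t hst => measure_mono fun x (hx : _ < _) =>
      (ENNReal.ofReal_le_ofReal hst).trans_lt hx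
  rw [← lintegral_add_left hm]
  refine setLIntegral_mono' measurableSet_Ioi fun t ht => ?_
  rcases lt_or_ge t 1 with h1 | h1
  · refine volume_add_volume_le_two_mul (measurableSet_lt measurable_const hf)
      (measurableSet_lt measurable_const hg) ?_ ?_ ?_
    · have : ENNReal.ofReal t < ⨆ x, f x := by rw [hf1]; simpa using h1
      exact lt_iSup_iff.1 this
    · have : ENNReal.ofReal t < ⨆ x, g x := by rw [hg1]; simpa using h1
      exact lt_iSup_iff.1 this
    · intro x hx y hy
      have := (ENNReal.mul_lt_mul hx hy).trans_le (H x y)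
      rw [← sq] at this
      exact (ENNReal.pow_right_strictMono two_ne_zero).lt_iff_lt.1 this
  · have e1 : {x | ENNReal.ofReal t < f x} = ∅ := by
      ext x
      have : f x ≤ 1 := hf1 ▸ le_iSup f x
      simpa using this.trans (by simpa using h1)
    have e2 : {x | ENNReal.ofReal t < g x} = ∅ := by
      ext x
      have : g x ≤ 1 := hg1 ▸ le_iSup g x
      simpa using this.trans (by simpa using h1)
    simp [e1, e2]

/-- Dividing `f` and `g` by their suprema, and `h` by the geometric mean of these, reduces to the
additive inequality; the arithmetic–geometric mean inequality makes it multiplicative. -/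
theorem prekopa_leindler_real_of_bounded {f g h : ℝ → ℝ≥0∞} (hf : Measurable f)
    (hg : Measurable g) (hh : Measurable h) (hf1 : ⨆ x, f x ≠ ∞) (hg1 : ⨆ x, g x ≠ ∞)
    (H : ∀ x y, f x * g y ≤ h ((2 : ℝ)⁻¹ * (x + y)) ^ 2) :
    (∫⁻ x, f x) * ∫⁻ x, g x ≤ (∫⁻ x, h x) ^ 2 := by
  set a := ⨆ x, f x with ha
  set b := ⨆ x, g x with hb
  rcases eq_or_ne a 0 with ha0 | ha0
  · have : f = 0 := by ext x; simpa [← ha, ha0] using le_iSup f x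
    simp [this]
  rcases eq_or_ne b 0 with hb0 | hb0
  · have : g = 0 := by ext x; simpa [← hb, hb0] using le_iSup g x
    simp [this]
  set c : ℝ≥0∞ := (a⁻¹ * b⁻¹) ^ (2⁻¹ : ℝ) with hc
  have hc2 : c ^ 2 = a⁻¹ * b⁻¹ := by
    rw [hc, ← ENNReal.rpow_natCast, ← ENNReal.rpow_mul]; simp
  have key := lintegral_add_lintegral_le_of_iSup_eq_one (f := fun x => a⁻¹ * f x)
    (g := fun x => b⁻¹ * g x) (h := fun x => c * h x) (hf.const_mul _) (hg.const_mul _)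
    (hh.const_mul _) (by rw [← ENNReal.mul_iSup, ← ha, ENNReal.inv_mul_cancel ha0 hf1])
    (by rw [← ENNReal.mul_iSup, ← hb, ENNReal.inv_mul_cancel hb0 hg1]) (by
      intro x y
      calc a⁻¹ * f x * (b⁻¹ * g y) = c ^ 2 * (f x * g y) := by rw [hc2]; ring
        _ ≤ _ := by rw [mul_pow]; gcongr; exact H x y)
  rw [lintegral_const_mul _ hf, lintegral_const_mul _ hg, lintegral_const_mul _ hh] at key
  have h4 := (four_mul_le_add_sq _ _).trans (pow_le_pow_left' key 2)
  have h5 : (4 * (a⁻¹ * b⁻¹)) * ((∫⁻ x, f x) * ∫⁻ x, g x) ≤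
      (4 * (a⁻¹ * b⁻¹)) * (∫⁻ x, h x) ^ 2 := by
    calc _ = 4 * ((a⁻¹ * ∫⁻ x, f x) * (b⁻¹ * ∫⁻ x, g x)) := by ring
      _ ≤ _ := h4
      _ = _ := by rw [← hc2]; ring
  refine (ENNReal.mul_le_mul_iff_right ?_ ?_).1 h5
  · simp [hf1, hg1]
  · exact ENNReal.mul_ne_top (by simp) (ENNReal.mul_ne_top (by simpa) (by simpa))

theorem prekopa_leindler_real {f g h : ℝ → ℝ≥0∞} (hf : Measurable f)
    (hg : Measurable g) (hh : Measurable h)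
    (H : ∀ x y, f x * g y ≤ h ((2 : ℝ)⁻¹ * (x + y)) ^ 2) :
    (∫⁻ x, f x) * ∫⁻ x, g x ≤ (∫⁻ x, h x) ^ 2 := by
  have trunc : ∀ {u : ℝ → ℝ≥0∞}, Measurable u →
      ∫⁻ x, u x = ⨆ N : ℕ, ∫⁻ x, min (u x) N := by
    intro u hu
    rw [← lintegral_iSup (fun N => hu.min measurable_const)
      (fun M N hMN x => min_le_min le_rfl (by exact_mod_cast hMN))]
    refine lintegral_congr fun x => ?_
    rw [← inf_iSup_eq, ENNReal.iSup_natCast]; simp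
  rw [trunc hf, trunc hg, ENNReal.iSup_mul]
  refine iSup_le fun M => ?_
  rw [ENNReal.mul_iSup]
  refine iSup_le fun N => ?_
  refine prekopa_leindler_real_of_bounded (hf.min measurable_const) (hg.min measurable_const) hh
    ?_ ?_ fun x y => (mul_le_mul' (min_le_left _ _) (min_le_left _ _)).trans (H x y)
  · exact ne_top_of_le_ne_top (ENNReal.natCast_ne_top M) (iSup_le fun x => min_le_right _ _)
  · exact ne_top_of_le_ne_top (ENNReal.natCast_ne_top N) (iSup_le fun x => min_le_right _ _)

/-- The midpoint case of the Prékopa–Leindler inequality. -/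
theorem prekopa_leindler {n : ℕ} {f g h : (Fin n → ℝ) → ℝ≥0∞} (hf : Measurable f)
    (hg : Measurable g) (hh : Measurable h)
    (H : ∀ x y, f x * g y ≤ h ((2 : ℝ)⁻¹ • (x + y)) ^ 2) :
    (∫⁻ x, f x) * ∫⁻ x, g x ≤ (∫⁻ x, h x) ^ 2 := by
  induction n with
  | zero =>
    have e : (volume : Measure (Fin 0 → ℝ)) = Measure.dirac 0 := Measure.volume_pi_eq_dirac 0
    rw [e, lintegral_dirac' _ hf, lintegral_dirac' _ hg, lintegral_dirac' _ hh]
    simpa using H 0 0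
  | succ n ih =>
    let e := (MeasurableEquiv.piFinSuccAbove (fun _ : Fin (n + 1) => ℝ) 0).symm
    have he : MeasurePreserving e :=
      (volume_preserving_piFinSuccAbove (fun _ : Fin (n + 1) => ℝ) 0).symm
    have split : ∀ {u : (Fin (n + 1) → ℝ) → ℝ≥0∞}, Measurable u →
        ∫⁻ x, u x = ∫⁻ t, ∫⁻ y, u (e (t, y)) := by
      intro u hu
      rw [← he.lintegral_comp hu, Measure.volume_eq_prod]
      exact lintegral_prod _ (hu.comp e.measurable).aemeasurable
    have meas : ∀ {u : (Fin (n + 1) → ℝ) → ℝ≥0∞}, Measurable u →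
        Measurable fun t => ∫⁻ y, u (e (t, y)) := fun hu =>
      (hu.comp e.measurable).lintegral_prod_right'
    have mid : ∀ (t s : ℝ) (y z : Fin n → ℝ),
        e ((2 : ℝ)⁻¹ * (t + s), (2 : ℝ)⁻¹ • (y + z)) = (2 : ℝ)⁻¹ • (e (t, y) + e (s, z)) := by
      intro t s y z
      ext i
      refine Fin.cases ?_ (fun j => ?_) i <;> simp [e, MeasurableEquiv.piFinSuccAbove, mul_add]
    rw [split hf, split hg, split hh]
    -- The inductive hypothesis on slices is exactly the hypothesis of the one-dimensional
    -- inequality for the slice integrals.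
    refine prekopa_leindler_real (meas hf) (meas hg) (meas hh) fun t s => ?_
    refine ih ?_ ?_ ?_ fun y z => ?_
    · exact hf.comp (e.measurable.comp measurable_prodMk_left)
    · exact hg.comp (e.measurable.comp measurable_prodMk_left)
    · exact hh.comp (e.measurable.comp measurable_prodMk_left)
    · rw [mid]; exact H _ _

/-- The isodiametric inequality for a seminorm. -/
theorem volume_le_volume_seminorm_le_half {n : ℕ} {q : Seminorm ℝ (EuclideanSpace ℝ (Fin n))}
    (hq : Continuous q) {D : Set (EuclideanSpace ℝ (Fin n))} {d : ℝ}
    (hD : ∀ x ∈ D, ∀ y ∈ D, q (x - y) ≤ d) : volume D ≤ volume {v | q v ≤ d / 2} := by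
  set K := closure D
  have hK : ∀ x ∈ K, ∀ y ∈ K, q (x - y) ≤ d := by
    have hc : IsClosed {p : EuclideanSpace ℝ (Fin n) × EuclideanSpace ℝ (Fin n) |
        q (p.1 - p.2) ≤ d} := isClosed_le (by fun_prop) continuous_const
    have : closure (D ×ˢ D) ⊆ {p | q (p.1 - p.2) ≤ d} :=
      closure_minimal (fun p hp => hD _ hp.1 _ hp.2) hc
    rw [closure_prod_eq] at this
    exact fun x hx y hy => this (mk_mem_prod hx hy)
  have hKm : MeasurableSet K := isClosed_closure.measurableSet
  have hSm : MeasurableSet {v | q v ≤ d / 2} :=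
    (isClosed_le hq continuous_const).measurableSet
  have he := PiLp.volume_preserving_toLp (Fin n)
  -- The midpoint of `x ∈ K` and `y ∈ -K` is half the difference of two points of `K`, hence lies in
  -- `{q ≤ d / 2}`; moreover `K` and `-K` have equal volume.
  have key := prekopa_leindler (n := n)
    (f := fun x => K.indicator 1 (WithLp.toLp 2 x))
    (g := fun x => (-K).indicator 1 (WithLp.toLp 2 x))
    (h := fun x => {v | q v ≤ d / 2}.indicator 1 (WithLp.toLp 2 x))
    ((measurable_one.indicator hKm).comp he.measurable)
    ((measurable_one.indicator hKm.neg).comp he.measurable)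
    ((measurable_one.indicator hSm).comp he.measurable) (by
      intro x y
      by_cases hx : WithLp.toLp 2 x ∈ K
      · by_cases hy : WithLp.toLp 2 y ∈ -K
        · have : WithLp.toLp 2 ((2 : ℝ)⁻¹ • (x + y)) ∈ {v | q v ≤ d / 2} := by
            have h1 := hK _ hx _ hy
            have h2 : WithLp.toLp 2 ((2 : ℝ)⁻¹ • (x + y)) =
                (2 : ℝ)⁻¹ • (WithLp.toLp 2 x - -WithLp.toLp 2 y) := by
              ext i; simp [mul_add]
            rw [mem_ofPred_eq, h2, map_smul_eq_mul]
            norm_num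
            rw [sub_neg_eq_add] at h1
            linarith
          rw [indicator_of_mem this, indicator_of_mem hx, indicator_of_mem hy]
          simp
        · simp [indicator_of_notMem hy]
      · simp [indicator_of_notMem hx])
  rw [he.lintegral_comp (measurable_one.indicator hKm),
    he.lintegral_comp (measurable_one.indicator hKm.neg),
    he.lintegral_comp (measurable_one.indicator hSm), lintegral_indicator_one hKm,
    lintegral_indicator_one hKm.neg, lintegral_indicator_one hSm, Measure.measure_neg, ← sq] at key
  exact (measure_mono subset_closure).trans 
    ((ENNReal.pow_right_strictMono two_ne_zero).le_iff_le.1 key)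

/-! ### Metric differentiability almost everywhere -/

/-- `g` is metrically differentiable at `x` along `E`, with metric derivative `s`. -/
def HasMetricDerivWithin {V X : Type*} [NormedAddCommGroup V] [NormedSpace ℝ V] [MetricSpace X]
    (g : V → X) (s : Seminorm ℝ V) (E : Set V) (x : V) : Prop :=
  ∀ ε > 0, ∃ δ > 0, ∀ y ∈ E, ‖y - x‖ < δ → |dist (g y) (g x) - s (y - x)| ≤ ε * ‖y - x‖

/-- One bounded function, the supremum `m` of all `|u k'|`, dominates every increment.
Differentiating its integral at a point gives a `δ` that serves all `k` at once. -/
theorem ae_forall_abs_sub_le_iSup_deriv {u : ℕ → ℝ → ℝ} {C : ℝ≥0}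
    (hu : ∀ k, LipschitzWith C (u k)) :
    ∀ᵐ t, ∀ ε > 0, ∃ δ > 0, ∀ h, |h| < δ → ∀ k,
      |u k (t + h) - u k t| ≤ ((⨆ j, |deriv (u j) t|) + ε) * |h| := by
  set m : ℝ → ℝ := fun t => ⨆ j, |deriv (u j) t|
  have hb : ∀ k t, |deriv (u k) t| ≤ C := fun k t => norm_deriv_le_of_lipschitz (hu k)
  have hbdd : ∀ t, BddAbove (range fun j => |deriv (u j) t|) := fun t =>
    ⟨C, by rintro _ ⟨j, rfl⟩; exact hb j t⟩
  have hm0 : ∀ t, 0 ≤ m t := fun t => (abs_nonneg _).trans (le_ciSup (hbdd t) 0)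
  have hmC : ∀ t, m t ≤ C := fun t => ciSup_le fun j => hb j t
  have hmm : Measurable m := Measurable.iSup fun j => (measurable_deriv (u j)).abs
  have hloc : LocallyIntegrable m volume :=
    (memLp_top_of_bound hmm.aestronglyMeasurable C (Eventually.of_forall fun t => by
      rw [Real.norm_of_nonneg (hm0 t)]; exact hmC t)).locallyIntegrable le_top
  have hint : ∀ a b, IntervalIntegrable m volume a b := fun a b =>
    (hloc.integrableOn_isCompact isCompact_uIcc).intervalIntegrable
  filter_upwards [_root_.LocallyIntegrable.ae_hasDerivAt_integral hloc] with t ht ε hε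
  have h1 := (hasDerivAt_iff_isLittleO_nhds_zero.1 (ht 0)).def hε
  obtain ⟨δ, hδ, h2⟩ := Metric.eventually_nhds_iff.1 h1
  refine ⟨δ, hδ, fun h hh k => ?_⟩
  have h3 := h2 (y := h) (by simpa using hh)
  rw [intervalIntegral.integral_interval_sub_left (hint _ _) (hint _ _)] at h3
  have h4 : |u k (t + h) - u k t| ≤ |∫ x in t..t + h, m x| := by
    rw [← ((hu k).lipschitzOnWith (s := uIcc t (t + h))).absolutelyContinuousOnInterval.integral_deriv_eq_sub]
    exact intervalIntegral.norm_integral_le_abs_of_norm_le (f := deriv (u k)) (g := m)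
      (Eventually.of_forall fun x => le_ciSup (hbdd x) k) (hint _ _)
  simp only [Real.norm_eq_abs, smul_eq_mul] at h3
  calc _ ≤ _ := h4
    _ ≤ |(∫ x in t..t + h, m x) - h * m t| + |h * m t| := by
      simpa using abs_add_le ((∫ x in t..t + h, m x) - h * m t) (h * m t)
    _ ≤ ε * |h| + |h| * m t := by rw [abs_mul, abs_of_nonneg (hm0 t)]; gcongr
    _ = _ := by ring

theorem bddAbove_range_abs_lineDeriv {V : Type*} [NormedAddCommGroup V]
    [NormedSpace ℝ V] {U : ℕ → V → ℝ} {C : ℝ≥0} (hU : ∀ k, LipschitzWith C (U k))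
    (x v : V) : BddAbove (range fun k => |lineDeriv ℝ (U k) x v|) :=
  ⟨C * ‖v‖, by rintro _ ⟨k, rfl⟩; exact norm_lineDeriv_le_of_lipschitz ℝ (hU k)⟩

theorem exists_forall_abs_sub_le_of_directional {V : Type*}
    [NormedAddCommGroup V] [NormedSpace ℝ V] [FiniteDimensional ℝ V] {F : V → ℝ} {s : Seminorm ℝ V} {C : ℝ≥0}
    (hF : ∀ v w, |F v - F w| ≤ C * ‖v - w‖) (hs : ∀ v, s v ≤ C * ‖v‖) {D : Set V} (hD : Dense D)
    (h : ∀ v ∈ D, ∀ ε > 0, ∃ δ > 0, ∀ t : ℝ, 0 ≤ t → t < δ → |F (t • v) - t * s v| ≤ ε * t)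
    {ε : ℝ} (hε : 0 < ε) : ∃ δ > 0, ∀ v, ‖v‖ < δ → |F v - s v| ≤ ε * ‖v‖ := by
  -- Replacing a direction by a point of an `η`-net of the sphere costs `C * η` in `F` and again in
  -- `s`; the directional estimate costs one more `η`.
  obtain ⟨η, hη, hηε⟩ : ∃ η > 0, (C + C + 1) * η = ε :=
    ⟨ε / (C + C + 1), by positivity, mul_div_cancel₀ ε (by positivity)⟩
  obtain ⟨q, hqs, q_fin, hq⟩ : ∃ q, q ⊆ D ∧ q.Finite ∧ sphere (0 : V) 1 ⊆ ⋃ y ∈ q, ball y η := by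
    refine (isCompact_sphere 0 1).elim_finite_subcover_image (fun y _ => isOpen_ball) fun z _ => ?_
    obtain ⟨y, ys, hy⟩ := Metric.mem_closure_iff.1 (hD z) η hη
    exact mem_biUnion ys hy
  have h1 : ∀ v ∈ q, ∀ᶠ t in 𝓝[≥] (0 : ℝ), |F (t • v) - t * s v| ≤ η * t := by
    intro v hv
    obtain ⟨δ, hδ, h2⟩ := h v (hqs hv) η hη
    filter_upwards [Ico_mem_nhdsGE hδ] with t ht using h2 t ht.1 ht.2
  obtain ⟨δ, hδ, h2⟩ := mem_nhdsGE_iff_exists_Ico_subset.1 (q_fin.eventually_all.2 h1)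
  refine ⟨δ, hδ, fun v hv => ?_⟩
  rcases eq_or_ne v 0 with rfl | v0
  · have := h2 ⟨le_refl (0 : ℝ), hδ⟩
    obtain ⟨y, hy⟩ | hqe := q.eq_empty_or_nonempty.symm
    · simpa using this y hy
    · have h3 := hD.nonempty
      obtain ⟨w, hw⟩ := h3
      obtain ⟨δ', hδ', h4⟩ := h w hw 1 one_pos
      simpa using h4 0 le_rfl hδ'
  set ρ := ‖v‖ with hρ
  have hρ0 : 0 < ρ := norm_pos_iff.2 v0
  set w := ρ⁻¹ • v
  have hw : ‖w‖ = 1 := by simp [w, norm_smul, ← hρ, hρ0.ne', abs_of_pos hρ0]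
  have hvw : v = ρ • w := by simp [w, smul_smul, hρ0.ne']
  obtain ⟨y, hyq, hy⟩ : ∃ y ∈ q, ‖w - y‖ < η := by
    simpa [← dist_eq_norm] using hq (mem_sphere_zero_iff_norm.2 hw)
  have h3 : |F (ρ • y) - ρ * s y| ≤ η * ρ := h2 ⟨hρ0.le, hv⟩ y hyq
  have h4 : |F v - F (ρ • y)| ≤ C * (ρ * η) := by
    refine (hF _ _).trans ?_
    rw [hvw, ← smul_sub, norm_smul, Real.norm_of_nonneg hρ0.le]
    gcongr
  have h5 : |ρ * s y - s v| ≤ ρ * (C * η) := by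
    rw [hvw, map_smul_eq_mul, Real.norm_of_nonneg hρ0.le, ← mul_sub, abs_mul, abs_of_pos hρ0]
    gcongr
    calc |s y - s w| ≤ s (y - w) := abs_sub_map_le_sub s y w
      _ ≤ C * ‖y - w‖ := hs _
      _ ≤ C * η := by rw [norm_sub_rev]; gcongr
  calc |F v - s v| = |(F v - F (ρ • y)) + (F (ρ • y) - ρ * s y) + (ρ * s y - s v)| := by
        congr 1; ring
    _ ≤ C * (ρ * η) + η * ρ + ρ * (C * η) := (abs_add_three _ _ _).trans (by gcongr)
    _ = ε * ρ := by rw [← hηε]; ring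

section
variable {V : Type*} [NormedAddCommGroup V] [NormedSpace ℝ V] [FiniteDimensional ℝ V]
  [MeasurableSpace V] [BorelSpace V]

theorem ae_forall_abs_sub_le_iSup_lineDeriv (μ : Measure V) [μ.IsAddHaarMeasure]
    {U : ℕ → V → ℝ} {C : ℝ≥0} (hU : ∀ k, LipschitzWith C (U k)) (v : V) :
    ∀ᵐ x ∂μ, ∀ ε > 0, ∃ δ > 0, ∀ h : ℝ, |h| < δ → ∀ k,
      |U k (x + h • v) - U k x| ≤ ((⨆ j, |lineDeriv ℝ (U j) x v|) + ε) * |h| := by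
  set m : V → ℝ := fun x => ⨆ j, |lineDeriv ℝ (U j) x v| with hm
  have hmm : Measurable m := Measurable.iSup fun j =>
    (measurable_lineDeriv (hU j).continuous).abs
  -- Rational increments and thresholds `1 / (i + 1)`, `1 / (d + 1)` make the good set measurable,
  -- so that Fubini along lines parallel to `v` applies; continuity of `U k` restores real
  -- increments.
  set S : Set V := ⋂ i : ℕ, ⋃ d : ℕ, ⋂ h : ℚ, ⋂ _ : |(h : ℝ)| < 1 / (d + 1 : ℝ), ⋂ k,
    {x | |U k (x + (h : ℝ) • v) - U k x| ≤ (m x + 1 / (i + 1 : ℝ)) * |(h : ℝ)|} with hS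
  have hSm : MeasurableSet S := by
    refine .iInter fun i => .iUnion fun d => .iInter fun h => .iInter fun _ => .iInter fun k => ?_
    refine measurableSet_le (Continuous.measurable ?_) (by fun_prop)
    have := (hU k).continuous
    fun_prop
  have hline : ∀ p, ∀ᵐ t : ℝ, p + t • v ∈ S := by
    intro p
    have hu : ∀ k, LipschitzWith (C * ‖v‖₊) fun t : ℝ => U k (p + t • v) := by
      intro k
      refine (hU k).comp (LipschitzWith.of_dist_le_mul fun s t => ?_)
      rw [dist_add_left, dist_eq_norm, ← sub_smul, norm_smul, mul_comm, dist_eq_norm]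
      rfl
    filter_upwards [ae_forall_abs_sub_le_iSup_deriv hu] with t ht
    have hd : ∀ k, deriv (fun t : ℝ => U k (p + t • v)) t = lineDeriv ℝ (U k) (p + t • v) v := by
      intro k
      have := deriv_comp_const_add (f := fun t : ℝ => U k (p + t • v)) t 0
      simp only [add_zero] at this
      rw [lineDeriv, ← this]
      simp only [add_smul, add_assoc]
    simp only [hd] at ht
    rw [hS]
    refine mem_iInter.2 fun i => ?_
    obtain ⟨δ, hδ, h1⟩ := ht (1 / (i + 1 : ℝ)) (by positivity)
    obtain ⟨d, hd⟩ := exists_nat_one_div_lt hδ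
    refine mem_iUnion.2 ⟨d, mem_iInter.2 fun h => mem_iInter.2 fun hh => mem_iInter.2 fun k => ?_⟩
    have := h1 h (hh.trans hd) k
    rwa [add_smul, ← add_assoc] at this
  filter_upwards [ae_mem_of_ae_add_linearMap_mem (LinearMap.toSpanSingleton ℝ V v) volume μ hSm
    (by simpa using hline)] with x hx ε hε
  obtain ⟨i, hi⟩ := exists_nat_one_div_lt hε
  obtain ⟨d, hd⟩ := mem_iUnion.1 (mem_iInter.1 hx i)
  refine ⟨1 / (d + 1 : ℝ), by positivity, fun h hh k => ?_⟩
  have hcl : IsClosed {h : ℝ | |U k (x + h • v) - U k x| ≤ (m x + 1 / (i + 1 : ℝ)) * |h|} := by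
    have := (hU k).continuous
    exact isClosed_le (by fun_prop) (by fun_prop)
  have hop : IsOpen {h : ℝ | |h| < 1 / (d + 1 : ℝ)} := isOpen_lt (by fun_prop) (by fun_prop)
  have h1 := (Rat.denseRange_cast (𝕜 := ℝ)).open_subset_closure_inter hop hh
  have h2 := closure_minimal (t := {h : ℝ | |U k (x + h • v) - U k x| ≤
    (m x + 1 / (i + 1 : ℝ)) * |h|}) (by
      rintro _ ⟨hq, q, rfl⟩
      exact mem_iInter.1 (mem_iInter.1 (mem_iInter.1 hd q) hq) k) hcl h1
  refine le_trans h2 ?_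
  gcongr

/-- The seminorm is the supremum over `k` of `|dU_k(x) v|`. In each direction of a countable dense
set, the upper bound is the estimate uniform in `k`, and the lower bound uses a single `k` that
nearly attains the supremum. -/
theorem ae_exists_seminorm_iSup_abs_sub (μ : Measure V) [μ.IsAddHaarMeasure]
    {U : ℕ → V → ℝ} {C : ℝ≥0} (hU : ∀ k, LipschitzWith C (U k)) :
    ∀ᵐ x ∂μ, ∃ s : Seminorm ℝ V, (∀ v, s v ≤ C * ‖v‖) ∧ ∀ ε > 0, ∃ δ > 0, ∀ v, ‖v‖ < δ →
      |(⨆ k, |U k (x + v) - U k x|) - s v| ≤ ε * ‖v‖ := by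
  obtain ⟨D, hDc, hD⟩ := TopologicalSpace.exists_countable_dense V
  filter_upwards [(ae_ball_iff hDc).2 fun v _ => ae_forall_abs_sub_le_iSup_lineDeriv μ hU v,
    ae_all_iff.2 fun k => (hU k).ae_differentiableAt (μ := μ)] with x hx hd
  have hl : ∀ k v, lineDeriv ℝ (U k) x v = fderiv ℝ (U k) x v := fun k v =>
    (hd k).lineDeriv_eq_fderiv
  have hb := bddAbove_range_abs_lineDeriv hU x
  simp only [hl] at hx hb
  have hsle : ∀ v, ⨆ k, |fderiv ℝ (U k) x v| ≤ C * ‖v‖ := fun v => ciSup_le fun k => by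
    rw [← hl]; exact norm_lineDeriv_le_of_lipschitz ℝ (hU k)
  set s : Seminorm ℝ V := Seminorm.of (fun v => ⨆ k, |fderiv ℝ (U k) x v|)
    (fun v w => ciSup_le fun k => by
      rw [map_add]
      exact (abs_add_le _ _).trans (add_le_add (le_ciSup (hb v) k) (le_ciSup (hb w) k)))
    (fun a v => by
      simp only [map_smul, smul_eq_mul, abs_mul, Real.norm_eq_abs]
      rw [Real.mul_iSup_of_nonneg (abs_nonneg a)])
  have hsv : ∀ v, s v = ⨆ k, |fderiv ℝ (U k) x v| := fun v => rfl
  refine ⟨s, hsle, fun ε hε => ?_⟩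
  have hFb : ∀ v, BddAbove (range fun k => |U k (x + v) - U k x|) := fun v =>
    ⟨C * ‖v‖, by
      rintro _ ⟨k, rfl⟩
      simpa [dist_eq_norm] using (hU k).dist_le_mul (x + v) x⟩
  have hF1 : ∀ v w, (⨆ k, |U k (x + v) - U k x|) ≤ (⨆ k, |U k (x + w) - U k x|) + C * ‖v - w‖ := by
    intro v w
    refine ciSup_le fun k => ?_
    have h1 : |U k (x + v) - U k (x + w)| ≤ C * ‖v - w‖ := by
      simpa [dist_eq_norm] using (hU k).dist_le_mul (x + v) (x + w)
    have h2 := le_ciSup (hFb w) k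
    have h3 := abs_sub_le (U k (x + v)) (U k (x + w)) (U k x)
    linarith
  refine exists_forall_abs_sub_le_of_directional (F := fun v => ⨆ k, |U k (x + v) - U k x|)
    (fun v w => abs_sub_le_iff.2 ⟨by linarith [hF1 v w], by
      have := hF1 w v
      rw [norm_sub_rev] at this
      linarith⟩) hsle hD (fun v hv η hη => ?_) hε
  obtain ⟨δ, hδ, h1⟩ := hx v hv η hη
  obtain ⟨k, hk⟩ := exists_lt_of_lt_ciSup (show s v - η / 2 < ⨆ k, |fderiv ℝ (U k) x v| by
    rw [hsv]; linarith)
  have h2 := ((hd k).hasFDerivAt.hasLineDerivAt v)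
  obtain ⟨δ', hδ', h3⟩ := Metric.eventually_nhds_iff.1
    ((hasLineDerivAt_iff_isLittleO_nhds_zero.1 h2).def (half_pos hη))
  refine ⟨min δ δ', lt_min hδ hδ', fun t ht0 ht => abs_sub_le_iff.2 ⟨?_, ?_⟩⟩
  · rw [sub_le_iff_le_add]
    refine ciSup_le fun j => ?_
    have := h1 t (by rw [abs_of_nonneg ht0]; exact ht.trans_le (min_le_left _ _)) j
    rw [abs_of_nonneg ht0, ← hsv] at this
    linarith
  · have h4 := h3 (y := t) (by simpa [abs_of_nonneg ht0] using ht.trans_le (min_le_right _ _))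
    have h5 := le_ciSup (hFb (t • v)) k
    simp only [Real.norm_eq_abs, smul_eq_mul, abs_of_nonneg ht0] at h4
    have h6 : t * |fderiv ℝ (U k) x v| ≤ |U k (x + t • v) - U k x| + η / 2 * t := by
      have h7 : |t * fderiv ℝ (U k) x v| = t * |fderiv ℝ (U k) x v| := by
        rw [abs_mul, abs_of_nonneg ht0]
      rw [← h7]
      have := abs_sub_abs_le_abs_sub (t * fderiv ℝ (U k) x v) (U k (x + t • v) - U k x)
      rw [abs_sub_comm (t * _)] at this
      linarith
    have h8 := mul_le_mul_of_nonneg_left hk.le ht0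
    have h9 : t * (s v - η / 2) = t * s v - η / 2 * t := by ring
    linarith

/-- A Lipschitz map into a metric space is metrically differentiable almost everywhere. -/
theorem ae_exists_hasMetricDerivWithin (μ : Measure V) [μ.IsAddHaarMeasure] {X : Type*}
    [MetricSpace X] {g : V → X} {E : Set V} {C : ℝ≥0} (hg : LipschitzOnWith C g E) :
    ∀ᵐ x ∂μ, x ∈ E → ∃ s : Seminorm ℝ V, (∀ v, s v ≤ C * ‖v‖) ∧ HasMetricDerivWithin g s E x := by
  rcases E.eq_empty_or_nonempty with rfl | hE
  · simp
  have := hE.to_subtype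
  obtain ⟨a, ha⟩ := TopologicalSpace.exists_dense_seq E
  -- Distances to a dense sequence of points recover the metric on `g '' E` as a supremum; McShane
  -- extension makes these functions Lipschitz on all of `V`.
  have hex : ∀ k, ∃ u : V → ℝ, LipschitzWith C u ∧ EqOn (fun y => dist (g y) (g (a k))) u E :=
    fun k => LipschitzOnWith.extend_real (LipschitzOnWith.of_dist_le_mul fun y hy z hz =>
      (abs_dist_sub_le _ _ _).trans (hg.dist_le_mul y hy z hz))
  choose U hU hUg using hex
  have hdist : ∀ x ∈ E, ∀ y ∈ E, ⨆ k, |U k y - U k x| = dist (g y) (g x) := by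
    intro x hx y hy
    have hb : ∀ k, |U k y - U k x| ≤ dist (g y) (g x) := fun k => by
      rw [← hUg k hx, ← hUg k hy]; exact abs_dist_sub_le _ _ _
    refine le_antisymm (ciSup_le hb) (le_of_forall_pos_le_add fun ε hε => ?_)
    obtain ⟨k, hk⟩ := ha.exists_dist_lt ⟨x, hx⟩ (show 0 < ε / (2 * (C + 1)) by positivity)
    have h1 : |U k y - U k x| ≤ ⨆ k, |U k y - U k x| :=
      le_ciSup (f := fun k => |U k y - U k x|) ⟨_, by rintro _ ⟨j, rfl⟩; exact hb j⟩ k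
    rw [← hUg k hx, ← hUg k hy] at h1
    have h2 : dist (g x) (g (a k)) ≤ C * (ε / (2 * (C + 1))) :=
      (hg.dist_le_mul x hx _ (a k).2).trans (by gcongr; exact hk.le)
    have h3 : C * (ε / (2 * (C + 1))) ≤ ε / 2 := by
      rw [mul_div_assoc', div_le_div_iff₀ (by positivity) (by positivity)]
      nlinarith
    have h4 := dist_triangle (g y) (g (a k)) (g x)
    rw [dist_comm (g (a k))] at h4
    have h5 := le_abs_self (dist (g y) (g (a k)) - dist (g x) (g (a k)))
    linarith
  filter_upwards [ae_exists_seminorm_iSup_abs_sub μ hU] with x ⟨s, hs, h⟩ hxE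
  refine ⟨s, hs, fun ε hε => ?_⟩
  obtain ⟨δ, hδ, h1⟩ := h ε hε
  refine ⟨δ, hδ, fun y hy hyx => ?_⟩
  have := h1 (y - x) hyx
  rwa [add_sub_cancel, hdist x hxE y hy] at this

end

/-! ### Hausdorff measure of images, via unit balls of seminorms -/

theorem continuous_seminorm_of_le {V : Type*} [NormedAddCommGroup V] [NormedSpace ℝ V]
    {p : Seminorm ℝ V} {b : ℝ} (hp : ∀ v, p v ≤ b * ‖v‖) : Continuous p := by
  refine (LipschitzWith.of_dist_le' (K := b) fun v w => ?_).continuous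
  rw [Real.dist_eq, dist_eq_norm]
  exact (abs_sub_map_le_sub p v w).trans (hp _)

section
variable {n : ℕ}

theorem volume_seminorm_le {p : Seminorm ℝ (EuclideanSpace ℝ (Fin n))} {a : ℝ} (ha : 0 < a)
    (hp : ∀ v, a * ‖v‖ ≤ p v) {r : ℝ} (hr : 0 ≤ r) :
    volume {v | p v ≤ r} = ENNReal.ofReal r ^ n * volume {v | p v ≤ 1} := by
  have : {v | p v ≤ r} = r • {v | p v ≤ 1} := by
    rcases hr.eq_or_lt with rfl | hr
    · rw [zero_smul_set ⟨0, by simp⟩]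
      ext v
      simp only [mem_ofPred_eq, Set.mem_zero]
      refine ⟨fun h => ?_, fun h => by simp [h]⟩
      have := hp v
      exact norm_le_zero_iff.1 (by nlinarith [norm_nonneg v])
    · ext v
      rw [mem_smul_set_iff_inv_smul_mem₀ hr.ne']
      simp only [mem_ofPred_eq, map_smul_eq_mul, norm_inv, Real.norm_of_nonneg hr.le]
      rw [inv_mul_le_iff₀ hr, mul_one]
  rw [this, Measure.addHaar_smul, finrank_euclideanSpace_fin, abs_of_nonneg (by positivity),
    ENNReal.ofReal_pow hr]

theorem volume_seminorm_le_one_ne_top {p : Seminorm ℝ (EuclideanSpace ℝ (Fin n))} {a : ℝ}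
    (ha : 0 < a) (hp : ∀ v, a * ‖v‖ ≤ p v) : volume {v | p v ≤ 1} ≠ ∞ := by
  refine (((isBounded_closedBall (x := 0) (r := 1 / a)).subset fun v (hv : p v ≤ 1) =>
    ?_).measure_lt_top).ne
  rw [mem_closedBall_zero_iff, le_div_iff₀ ha, mul_comm]
  exact (hp v).trans hv

theorem hausdorffMeasure_image_null {Y : Type*} [MetricSpace Y] [MeasurableSpace Y] [BorelSpace Y]
    {h : EuclideanSpace ℝ (Fin n) → Y} {C : ℝ≥0} {A : Set (EuclideanSpace ℝ (Fin n))}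
    (hh : LipschitzOnWith C h A) (hA : volume A = 0) : μH[n] (h '' A) = 0 := by
  rw [← nonpos_iff_eq_zero]
  refine (hh.hausdorffMeasure_image_le (Nat.cast_nonneg n)).trans ?_
  rw [← EuclideanSpace.euclideanHausdorffMeasure_eq_volume, Measure.euclideanHausdorffMeasure_def,
    Measure.smul_apply, ENNReal.smul_def, smul_eq_mul, mul_eq_zero] at hA
  have := hA.resolve_left
    (by simpa using Measure.addHaarScalarFactor_volume_hausdorffMeasure_ne_zero n)
  rw [this, mul_zero]

/-- A covering argument: the Hausdorff measure of the image of `A` is bounded by the volume of `A`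
if the map is controlled to first order by seminorms with unit balls of volume at least `M`. -/
theorem mul_hausdorffMeasure_image_le {Y : Type*} [MetricSpace Y] [MeasurableSpace Y]
    [BorelSpace Y] {h : EuclideanSpace ℝ (Fin n) → Y} {C : ℝ≥0}
    {A : Set (EuclideanSpace ℝ (Fin n))} (hh : LipschitzOnWith C h A)
    {p : EuclideanSpace ℝ (Fin n) → Seminorm ℝ (EuclideanSpace ℝ (Fin n))} {a b : ℝ} (ha : 0 < a)
    (hb : 0 < b) (hpa : ∀ x ∈ A, ∀ v, a * ‖v‖ ≤ p x v) (hpb : ∀ x ∈ A, ∀ v, p x v ≤ b * ‖v‖)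
    {M : ℝ≥0} (hM : ∀ x ∈ A, M ≤ volume {v | p x v ≤ 1})
    (hp : ∀ x ∈ A, ∃ δ > 0, ∀ y ∈ A, ‖y - x‖ < δ → dist (h y) (h x) ≤ p x (y - x)) :
    M * μH[n] (h '' A) ≤ 2 ^ n * volume A := by
  rcases eq_or_ne M 0 with rfl | hM0
  · simp
  suffices H : ∀ U, A ⊆ U → IsOpen U → M * μH[n] (h '' A) ≤ 2 ^ n * volume U by
    refine ENNReal.le_of_forall_pos_le_add fun ε hε _ => ?_
    obtain ⟨U, hAU, hU, hUε⟩ := A.exists_isOpen_le_add volume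
      (ε := ε / 2 ^ n) (by simpa using hε.ne')
    refine (H U hAU hU).trans ((mul_le_mul_right hUε _).trans ?_)
    rw [mul_add, ENNReal.mul_div_cancel (by simp) (by simp)]
  intro U hAU hU
  let B : EuclideanSpace ℝ (Fin n) × ℝ → Set (EuclideanSpace ℝ (Fin n)) :=
    fun i => {y | p i.1 (y - i.1) ≤ i.2}
  have hcont : ∀ x ∈ A, Continuous (p x) := fun x hx => continuous_seminorm_of_le (hpb x hx)
  have hBvol : ∀ i : EuclideanSpace ℝ (Fin n) × ℝ, i.1 ∈ A → 0 ≤ i.2 →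
      volume (B i) = ENNReal.ofReal i.2 ^ n * volume {v | p i.1 v ≤ 1} := by
    intro i hi hi0
    rw [← volume_seminorm_le ha (hpa _ hi) hi0]
    have : B i = (fun y => y + -i.1) ⁻¹' {v | p i.1 v ≤ i.2} := by
      ext y; simp [B, sub_eq_add_neg]
    rw [this, measure_preimage_add_right]
  have hBball : ∀ i : EuclideanSpace ℝ (Fin n) × ℝ, i.1 ∈ A →
      B i ⊆ closedBall i.1 (i.2 / a) := by
    intro i hi y hy
    rw [mem_closedBall, dist_eq_norm, le_div_iff₀ ha, mul_comm]
    exact (hpa _ hi _).trans hy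
  have hballB : ∀ i : EuclideanSpace ℝ (Fin n) × ℝ, i.1 ∈ A →
      closedBall i.1 (i.2 / b) ⊆ B i := by
    intro i hi y hy
    rw [mem_closedBall, dist_eq_norm, le_div_iff₀ hb, mul_comm] at hy
    exact (hpb _ hi _).trans hy
  -- Indices of the fine cover at scale `1 / (m + 1)`: a centre and a seminorm radius `r`, where `r
  -- / a` is the radius of an enclosing Euclidean ball contained in `U`.
  let t : ℕ → Set (EuclideanSpace ℝ (Fin n) × ℝ) := fun m =>
    {i | i.1 ∈ A ∧ 0 < i.2 ∧ i.2 / a ≤ 1 / (m + 1 : ℝ) ∧ closedBall i.1 (i.2 / a) ⊆ U ∧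
      ∀ y ∈ A, ‖y - i.1‖ ≤ i.2 / a → dist (h y) (h i.1) ≤ p i.1 (y - i.1)}
  have hvit : ∀ m, ∃ u ⊆ t m, u.Countable ∧ u.PairwiseDisjoint B ∧
      volume (A \ ⋃ i ∈ u, B i) = 0 := by
    intro m
    -- `B i` contains the Euclidean ball of radius `r / b`, and the tripled enclosing ball has
    -- radius `3 * r / a`; the constant is the ratio of their volumes.
    refine Vitali.exists_disjoint_covering_ae volume A (t m) (Real.toNNReal ((3 * b / a) ^ n))
      (fun i => i.2 / a) (fun i => i.1) B (fun i hi => hBball i hi.1) ?_ ?_ ?_ ?_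
    · intro i hi
      refine le_trans (le_of_eq ?_) (mul_le_mul_right (measure_mono (hballB i hi.1)) _)
      have h2 := hi.2.1
      rw [Measure.addHaar_closedBall _ _ (by positivity), Measure.addHaar_closedBall _ _ (by positivity),
        finrank_euclideanSpace_fin, ← mul_assoc]
      congr 1
      change _ = ENNReal.ofReal _ * _
      rw [← ENNReal.ofReal_mul (by positivity), ← mul_pow]
      congr 2
      field_simp
    · intro i hi
      refine ⟨i.1, mem_interior.2 ⟨ball i.1 (i.2 / b),
        ball_subset_closedBall.trans (hballB i hi.1), isOpen_ball, ?_⟩⟩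
      exact mem_ball_self (div_pos hi.2.1 hb)
    · intro i hi
      have := hcont _ hi.1
      exact isClosed_le (by fun_prop) continuous_const
    · intro x hx ε hε
      obtain ⟨δ, hδ, h1⟩ := hp x hx
      obtain ⟨ρ, hρ, h2⟩ := Metric.isOpen_iff.1 hU x (hAU hx)
      set s := min (min ε (1 / (m + 1 : ℝ))) (min (δ / 2) (ρ / 2)) with hs
      have hs0 : 0 < s := by positivity
      have hsa : s * a / a = s := by field_simp
      refine ⟨(x, s * a), ⟨hx, by positivity, ?_, ?_, ?_⟩, ?_, rfl⟩
      · simp only [hsa]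
        exact (min_le_left _ _).trans (min_le_right _ _)
      · simp only [hsa]
        refine (closedBall_subset_ball ?_).trans h2
        have : s ≤ ρ / 2 := (min_le_right _ _).trans (min_le_right _ _)
        linarith
      · simp only [hsa]
        intro y hy hyx
        have : s ≤ δ / 2 := (min_le_right _ _).trans (min_le_left _ _)
        exact h1 y hy (by linarith)
      · simp only [hsa]
        exact (min_le_left _ _).trans (min_le_left _ _)
  choose u hut huc hud hu0 using hvit
  set Z := ⋃ m, A \ ⋃ i ∈ u m, B i with hZ
  have hZ0 : μH[n] (h '' Z) = 0 := hausdorffMeasure_image_null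
    (hh.mono (iUnion_subset fun m => sdiff_subset)) (measure_iUnion_null hu0)
  -- The image of a seminorm ball of radius `r` has diameter at most `2 * r`, and `r ^ n * M` is at
  -- most the volume of that ball; disjointness inside `U` bounds the sum.
  have hsum : ∀ m, ∑' i : u m, ediam (h '' (A ∩ B i)) ^ (n : ℝ) ≤ 2 ^ n * volume U / M := by
    intro m
    have := (huc m).to_subtype
    rw [ENNReal.le_div_iff_mul_le (Or.inl (by simpa using hM0)) (Or.inl (by simp)),
      ← ENNReal.tsum_mul_right]
    calc ∑' i : u m, ediam (h '' (A ∩ B i)) ^ (n : ℝ) * M ≤ ∑' i : u m, 2 ^ n * volume (B i) := by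
          refine ENNReal.tsum_le_tsum fun i => ?_
          obtain ⟨hiA, hi0, -, -, hi⟩ := hut m i.2
          have hd : ediam (h '' (A ∩ B i)) ≤ ENNReal.ofReal (2 * i.1.2) := by
            refine ediam_le fun _ ⟨y, hy, hy'⟩ _ ⟨z, hz, hz'⟩ => ?_
            subst hy' hz'
            rw [edist_dist]
            refine ENNReal.ofReal_le_ofReal ?_
            have h1 := hi y hy.1 (by simpa [dist_eq_norm] using hBball i hiA hy.2)
            have h2 := hi z hz.1 (by simpa [dist_eq_norm] using hBball i hiA hz.2)
            have h3 : p i.1.1 (y - i.1.1) ≤ i.1.2 := hy.2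
            have h4 : p i.1.1 (z - i.1.1) ≤ i.1.2 := hz.2
            have := dist_triangle_right (h y) (h z) (h i.1.1)
            linarith
          rw [hBvol i hiA hi0.le, ENNReal.rpow_natCast, ← mul_assoc, ← mul_pow]
          refine mul_le_mul' (pow_le_pow_left' (hd.trans_eq ?_) n) (hM _ hiA)
          rw [ENNReal.ofReal_mul (by norm_num)]; simp
      _ = 2 ^ n * volume (⋃ i ∈ u m, B i) := by
          rw [ENNReal.tsum_mul_left, measure_biUnion (huc m) (hud m)]
          intro i hi
          have := hcont _ (hut m hi).1
          exact (isClosed_le (by fun_prop) continuous_const).measurableSet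
      _ ≤ 2 ^ n * volume U := by
          gcongr
          exact iUnion₂_subset fun i hi => (hBball i (hut m hi).1).trans (hut m hi).2.2.2.1
  have hmain : μH[n] (h '' (A \ Z)) ≤ 2 ^ n * volume U / M := by
    have : ∀ m, Countable (u m) := fun m => (huc m).to_subtype
    refine (Measure.hausdorffMeasure_le_liminf_tsum (n : ℝ) (h '' (A \ Z)) (l := atTop)
      (fun m : ℕ => ENNReal.ofReal (2 * C * (1 / (m + 1 : ℝ)))) ?_
      (fun m (i : u m) => h '' (A ∩ B i)) ?_ ?_).trans ?_
    · have := (tendsto_one_div_add_atTop_nhds_zero_nat (𝕜 := ℝ)).const_mul (2 * (C : ℝ))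
      simpa using ENNReal.tendsto_ofReal this
    · refine Eventually.of_forall fun m i => ediam_le fun _ ⟨y, hy, hy'⟩ _ ⟨z, hz, hz'⟩ => ?_
      subst hy' hz'
      rw [edist_dist]
      refine ENNReal.ofReal_le_ofReal ?_
      obtain ⟨hiA, hi0, hi1, -, -⟩ := hut m i.2
      have h1 := hBball i hiA hy.2
      have h2 := hBball i hiA hz.2
      rw [mem_closedBall] at h1 h2
      have h3 := hh.dist_le_mul y hy.1 z hz.1
      have h4 : dist y z ≤ 2 * (1 / (m + 1 : ℝ)) := by
        have := dist_triangle_right y z i.1.1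
        linarith
      calc _ ≤ _ := h3
        _ ≤ C * (2 * (1 / (m + 1 : ℝ))) := by gcongr
        _ = _ := by ring
    · refine Eventually.of_forall fun m => ?_
      rintro _ ⟨y, ⟨hyA, hyZ⟩, rfl⟩
      by_contra hy
      refine hyZ (mem_iUnion.2 ⟨m, hyA, fun hy' => hy ?_⟩)
      obtain ⟨i, hi, hyi⟩ := mem_iUnion₂.1 hy'
      exact mem_iUnion.2 ⟨⟨i, hi⟩, mem_image_of_mem h ⟨hyA, hyi⟩⟩
    · exact liminf_le_of_le (by isBoundedDefault) fun c hc =>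
        let ⟨m, hm⟩ := hc.exists
        hm.trans (hsum m)
  have hle : μH[n] (h '' A) ≤ 2 ^ n * volume U / M := by
    refine le_trans (measure_mono (t := h '' (A \ Z) ∪ h '' Z) ?_) ((measure_union_le _ _).trans ?_)
    · rw [← image_union, sdiff_union_self]
      exact image_mono subset_union_left
    · rw [hZ0, add_zero]; exact hmain
  rw [mul_comm]
  exact (ENNReal.le_div_iff_mul_le (Or.inl (by simpa using hM0)) (Or.inl (by simp))).1 hle

/-- For any cover of `g '' A`, the preimage of a covering set in `A` has `q`-diameter at most the
diameter of that set; the isodiametric inequality bounds its volume. -/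
theorem volume_le_mul_hausdorffMeasure_image {X : Type*} [MetricSpace X] [MeasurableSpace X]
    [BorelSpace X] {g : EuclideanSpace ℝ (Fin n) → X} {A : Set (EuclideanSpace ℝ (Fin n))}
    {q : Seminorm ℝ (EuclideanSpace ℝ (Fin n))} (hqc : Continuous q) {a : ℝ} (ha : 0 < a)
    (hqa : ∀ v, a * ‖v‖ ≤ q v) (hg : ∀ x ∈ A, ∀ y ∈ A, q (x - y) ≤ dist (g x) (g y)) :
    2 ^ n * volume A ≤ volume {v | q v ≤ 1} * μH[n] (g '' A) := by
  set m := volume {v | q v ≤ 1} with hm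
  have hmt : m ≠ ∞ := volume_seminorm_le_one_ne_top ha hqa
  have hm0 : m ≠ 0 := by
    refine (lt_of_lt_of_le ?_ (measure_mono (s := {v | q v < 1}) fun v (hv : q v < 1) => hv.le)).ne'
    exact (isOpen_lt hqc continuous_const).measure_pos volume ⟨0, by simp⟩
  rw [mul_comm m, ← ENNReal.div_le_iff_le_mul (Or.inl hm0) (Or.inl hmt),
    Measure.hausdorffMeasure_apply]
  -- Any scale would do; 1 only ensures that the covering sets have finite diameter.
  refine le_iSup₂_of_le 1 one_pos (le_iInf₂ fun t ht => le_iInf fun htd => ?_)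
  have hi : ∀ i, 2 ^ n * volume (A ∩ g ⁻¹' t i) ≤
      (⨆ _ : (t i).Nonempty, ediam (t i) ^ (n : ℝ)) * m := by
    intro i
    rcases (A ∩ g ⁻¹' t i).eq_empty_or_nonempty with he | ⟨x, hx⟩
    · simp [he]
    have hne : (t i).Nonempty := ⟨g x, hx.2⟩
    have hdt : ediam (t i) ≠ ∞ := ne_top_of_le_ne_top ENNReal.one_ne_top (htd i)
    set d := (ediam (t i)).toReal
    have h1 := volume_le_volume_seminorm_le_half hqc (D := A ∩ g ⁻¹' t i) (d := d)
      fun x hx y hy => (hg x hx.1 y hy.1).trans (by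
        rw [dist_edist]
        exact ENNReal.toReal_mono hdt (edist_le_ediam_of_mem hx.2 hy.2))
    rw [volume_seminorm_le ha hqa (by positivity)] at h1
    rw [iSup_pos hne, ENNReal.rpow_natCast]
    refine (mul_le_mul_right h1 _).trans (le_of_eq ?_)
    rw [← mul_assoc, ← mul_pow]
    congr 2
    rw [ENNReal.ofReal_div_of_pos two_pos, ENNReal.ofReal_toReal hdt]
    simp [ENNReal.mul_div_cancel]
  rw [ENNReal.div_le_iff_le_mul (Or.inl hm0) (Or.inl hmt), ← ENNReal.tsum_mul_right]
  calc 2 ^ n * volume A ≤ 2 ^ n * ∑' i, volume (A ∩ g ⁻¹' t i) := by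
        gcongr
        refine (measure_mono fun x hx => ?_).trans (measure_iUnion_le _)
        obtain ⟨i, hi⟩ := mem_iUnion.1 (ht (mem_image_of_mem g hx))
        exact mem_iUnion.2 ⟨i, hx, hi⟩
    _ = ∑' i, 2 ^ n * volume (A ∩ g ⁻¹' t i) := ENNReal.tsum_mul_left.symm
    _ ≤ _ := ENNReal.tsum_le_tsum hi

end

/-! ### Comparing unit balls of seminorms -/

section
variable {n : ℕ}

/-- The open ball `{p < 1}` is contained in the increasing union of these closed unit balls, so a
degenerate seminorm can be made a norm at an arbitrarily small loss of volume. -/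
theorem exists_lt_volume_add_smul_norm_le {p : Seminorm ℝ (EuclideanSpace ℝ (Fin n))} {c : ℝ≥0∞}
    (h : c < volume {v | p v < 1}) : ∃ k : ℕ,
      c < volume {v | (p + (1 / (k + 1 : ℝ≥0)) • normSeminorm ℝ (EuclideanSpace ℝ (Fin n))) v ≤ 1} := by
  set T : ℕ → Set (EuclideanSpace ℝ (Fin n)) := fun k =>
    {v | (p + (1 / (k + 1 : ℝ≥0)) • normSeminorm ℝ (EuclideanSpace ℝ (Fin n))) v ≤ 1} with hT
  have hTv : ∀ k v, v ∈ T k ↔ p v + 1 / (k + 1 : ℝ) * ‖v‖ ≤ 1 := by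
    intro k v
    simp [hT, NNReal.smul_def]
  have hmono : Monotone T := by
    intro k l hkl v hv
    rw [hTv] at hv ⊢
    refine le_trans ?_ hv
    gcongr
  have hsub : {v | p v < 1} ⊆ ⋃ k, T k := by
    intro v (hv : p v < 1)
    have : Tendsto (fun k : ℕ => p v + 1 / (k + 1 : ℝ) * ‖v‖) atTop (𝓝 (p v + 0 * ‖v‖)) :=
      tendsto_const_nhds.add (tendsto_one_div_add_atTop_nhds_zero_nat.mul_const _)
    obtain ⟨k, hk⟩ := (this.eventually (ge_mem_nhds (by simpa using hv))).exists
    exact mem_iUnion.2 ⟨k, (hTv k v).2 hk⟩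
  have h1 := h.trans_le (measure_mono hsub)
  rw [hmono.measure_iUnion] at h1
  exact lt_iSup_iff.1 h1

/-- A small Euclidean ball inside `{p < 1}` can be translated along the kernel of `p` to infinitely
many disjoint positions. -/
theorem volume_seminorm_lt_one_eq_top {p : Seminorm ℝ (EuclideanSpace ℝ (Fin n))}
    (hp : Continuous p) {v : EuclideanSpace ℝ (Fin n)} (hv : v ≠ 0) (hpv : p v = 0) :
    volume {v | p v < 1} = ∞ := by
  obtain ⟨r, hr, hball⟩ := Metric.isOpen_iff.1 (isOpen_lt hp continuous_const) 0
    (show (0 : EuclideanSpace ℝ (Fin n)) ∈ {v | p v < 1} by simp)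
  set w := (2 * r / ‖v‖) • v with hw
  have hwn : ‖w‖ = 2 * r := by
    rw [hw, norm_smul, Real.norm_of_nonneg (by positivity)]
    field_simp [norm_ne_zero_iff.2 hv]
  have hpw : p w = 0 := by rw [hw, map_smul_eq_mul, hpv, mul_zero]
  have hsub : ⋃ k : ℕ, ball ((k : ℝ) • w) r ⊆ {v | p v < 1} := by
    refine iUnion_subset fun k y hy => ?_
    have h1 : p (y - (k : ℝ) • w) < 1 := hball (by simpa [dist_eq_norm] using hy)
    have h2 : p y ≤ p (y - (k : ℝ) • w) + p ((k : ℝ) • w) := by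
      simpa using map_add_le_add p (y - (k : ℝ) • w) ((k : ℝ) • w)
    rw [map_smul_eq_mul, hpw, mul_zero, add_zero] at h2
    exact h2.trans_lt h1
  have hdisj : Pairwise (Function.onFun Disjoint fun k : ℕ => ball ((k : ℝ) • w) r) := by
    intro k l hkl
    refine ball_disjoint_ball ?_
    rw [dist_eq_norm, ← sub_smul, norm_smul, hwn]
    have : (1 : ℝ) ≤ ‖(k : ℝ) - l‖ := by
      have h3 : (1 : ℤ) ≤ |(k : ℤ) - l| := Int.one_le_abs (sub_ne_zero.2 (by exact_mod_cast hkl))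
      rw [Real.norm_eq_abs]
      exact_mod_cast h3
    nlinarith
  refine top_unique (le_trans ?_ (measure_mono hsub))
  rw [measure_iUnion hdisj fun k => measurableSet_ball]
  have : ∀ k : ℕ, volume (ball ((k : ℝ) • w) r) = volume (ball (0 : EuclideanSpace ℝ (Fin n)) r) :=
    fun k => Measure.addHaar_ball_center volume _ r
  simp only [this]
  rw [ENNReal.tsum_const_eq_top_of_ne_zero (measure_ball_pos volume _ hr).ne']

theorem exists_seminorm_eq_zero {p : Seminorm ℝ (EuclideanSpace ℝ (Fin n))} (hp : Continuous p)
    (h : ¬ ∃ a > 0, ∀ v, a * ‖v‖ ≤ p v) : ∃ v ≠ 0, p v = 0 := by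
  by_contra! hv
  refine h ?_
  rcases (sphere (0 : EuclideanSpace ℝ (Fin n)) 1).eq_empty_or_nonempty with he | hne
  · refine ⟨1, one_pos, fun v => ?_⟩
    rcases eq_or_ne v 0 with rfl | h0
    · simp
    · have : ‖v‖⁻¹ • v ∈ sphere (0 : EuclideanSpace ℝ (Fin n)) 1 := by
        simp [norm_smul, norm_ne_zero_iff.2 h0]
      simp [he] at this
  · obtain ⟨w, hw, hmin⟩ := (isCompact_sphere _ _).exists_isMinOn hne hp.continuousOn
    have hw1 : ‖w‖ = 1 := by simpa using hw
    have hw0 : w ≠ 0 := by rintro rfl; simp at hw1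
    refine ⟨p w, lt_of_le_of_ne (apply_nonneg p w) (hv w hw0).symm, fun v => ?_⟩
    rcases eq_or_ne v 0 with rfl | h0
    · simp
    · have h1 : ‖v‖⁻¹ • v ∈ sphere (0 : EuclideanSpace ℝ (Fin n)) 1 := by
        simp [norm_smul, norm_ne_zero_iff.2 h0]
      have h2 := hmin h1
      simp only [mem_ofPred_eq, map_smul_eq_mul, norm_inv, norm_norm] at h2
      rwa [le_inv_mul_iff₀ (norm_pos_iff.2 h0), mul_comm] at h2

/-- The larger ball contains the nonempty open set `{p < 1} ∩ {1 < q}` in addition to `{q < 1}`; the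
closed and open `q`-balls have the same volume by scaling. -/
theorem volume_seminorm_le_one_lt {p q : Seminorm ℝ (EuclideanSpace ℝ (Fin n))}
    (hp : Continuous p) (hq : Continuous q) {a : ℝ} (ha : 0 < a) (hqa : ∀ v, a * ‖v‖ ≤ q v)
    (hpq : ∀ v, p v ≤ q v) {v : EuclideanSpace ℝ (Fin n)} (hv : p v ≠ q v) :
    volume {v | q v ≤ 1} < volume {v | p v < 1} := by
  have hlt : p v < q v := lt_of_le_of_ne (hpq v) hv
  have hq0 : 0 < q v := (apply_nonneg p v).trans_lt hlt
  set O : Set (EuclideanSpace ℝ (Fin n)) := {v | p v < 1} ∩ {v | 1 < q v} with hO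
  have hOo : IsOpen O := (isOpen_lt hp continuous_const).inter (isOpen_lt continuous_const hq)
  have hOne : O.Nonempty := by
    set c := (p v + q v) / 2
    have hc : 0 < c := by have := apply_nonneg p v; positivity
    refine ⟨c⁻¹ • v, ?_, ?_⟩
    · simp only [mem_ofPred_eq, map_smul_eq_mul, norm_inv, Real.norm_of_nonneg hc.le]
      rw [inv_mul_lt_iff₀ hc]; simp only [c]; linarith
    · simp only [mem_ofPred_eq, map_smul_eq_mul, norm_inv, Real.norm_of_nonneg hc.le]
      rw [lt_inv_mul_iff₀ hc]; simp only [c]; linarith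
  have h1 : volume {v | q v ≤ 1} ≤ volume {v | q v < 1} := by
    have ht : Tendsto (fun r : ℝ => ENNReal.ofReal r ^ n * volume {v | q v ≤ 1}) (𝓝[<] 1)
        (𝓝 (ENNReal.ofReal 1 ^ n * volume {v | q v ≤ 1})) := by
      refine ENNReal.Tendsto.mul_const ?_ (Or.inr (volume_seminorm_le_one_ne_top ha hqa))
      refine ((ENNReal.continuous_pow n).tendsto _).comp ?_
      exact (ENNReal.continuous_ofReal.tendsto 1).mono_left nhdsWithin_le_nhds
    rw [ENNReal.ofReal_one, one_pow, one_mul] at ht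
    refine le_of_tendsto ht ?_
    filter_upwards [Ioo_mem_nhdsLT (show (0 : ℝ) < 1 from one_pos)] with r hr
    rw [← volume_seminorm_le ha hqa hr.1.le]
    exact measure_mono fun v (hv : q v ≤ r) => hv.trans_lt hr.2
  have hfin : volume {v | q v < 1} ≠ ∞ := ne_top_of_le_ne_top
    (volume_seminorm_le_one_ne_top ha hqa) (measure_mono fun v (hv : q v < 1) => hv.le)
  calc volume {v | q v ≤ 1} ≤ volume {v | q v < 1} := h1
    _ < volume {v | q v < 1} + volume O :=
        ENNReal.lt_add_right hfin (hOo.measure_pos volume hOne).ne'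
    _ = volume ({v | q v < 1} ∪ O) := by
        refine (measure_union ?_ hOo.measurableSet).symm
        refine disjoint_left.2 fun v (hv : q v < 1) hv' => ?_
        exact lt_asymm hv hv'.2
    _ ≤ volume {v | p v < 1} :=
        measure_mono (union_subset (fun v (hv : q v < 1) => (hpq v).trans_lt hv) inter_subset_left)

/-- Makes the strict volume inequality stable: `q' = q / τ` with `τ` slightly above 1, and the
margin `ε` later absorbs both the variation of the seminorms and the metric differentiability error,
each at most `ε / 2`. -/
theorem exists_seminorm_gap {p q : Seminorm ℝ (EuclideanSpace ℝ (Fin n))}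
    (hp : Continuous p) (hq : Continuous q) {a : ℝ} (ha : 0 < a) (hqa : ∀ v, a * ‖v‖ ≤ q v)
    (hpq : ∀ v, p v ≤ q v) {v : EuclideanSpace ℝ (Fin n)} (hv : p v ≠ q v) :
    ∃ ε : ℝ≥0, 0 < ε ∧ ∃ (M : ℝ≥0) (q' : Seminorm ℝ (EuclideanSpace ℝ (Fin n))),
      volume {v | q' v ≤ 1} < M ∧
      M ≤ volume {v | (p + ε • normSeminorm ℝ (EuclideanSpace ℝ (Fin n))) v ≤ 1} ∧
      (∃ a' > 0, ∀ v, a' * ‖v‖ ≤ q' v) ∧ ∀ v, q' v + ε * ‖v‖ ≤ q v := by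
  obtain ⟨M, hM1, hM2⟩ := ENNReal.lt_iff_exists_nnreal_btwn.1
    (volume_seminorm_le_one_lt hp hq ha hqa hpq hv)
  obtain ⟨k, hk⟩ := exists_lt_volume_add_smul_norm_le hM2
  obtain ⟨τ, hτ1, hτ⟩ : ∃ τ : ℝ≥0, 1 < τ ∧
      ENNReal.ofReal τ ^ n * volume {v | q v ≤ 1} < M := by
    have ht : Tendsto (fun r : ℝ≥0 => ENNReal.ofReal r ^ n * volume {v | q v ≤ 1}) (𝓝[>] 1)
        (𝓝 (ENNReal.ofReal (1 : ℝ≥0) ^ n * volume {v | q v ≤ 1})) := by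
      refine ENNReal.Tendsto.mul_const ?_ (Or.inr (volume_seminorm_le_one_ne_top ha hqa))
      refine ((ENNReal.continuous_pow n).tendsto _).comp ?_
      exact ((ENNReal.continuous_ofReal.comp NNReal.continuous_coe).tendsto 1).mono_left
        nhdsWithin_le_nhds
    rw [NNReal.coe_one, ENNReal.ofReal_one, one_pow, one_mul] at ht
    obtain ⟨τ, h1, h2⟩ := ((ht.eventually (gt_mem_nhds hM1)).and self_mem_nhdsWithin).exists
    exact ⟨τ, h2, h1⟩
  have hτ0 : 0 < τ := one_pos.trans hτ1
  have hτ0' : (0 : ℝ) < τ := hτ0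
  have hτi : (τ : ℝ)⁻¹ < 1 := inv_lt_one_of_one_lt₀ (by exact_mod_cast hτ1)
  have hq' : ∀ v, (τ⁻¹ • q) v = (τ : ℝ)⁻¹ * q v := fun v => by simp [NNReal.smul_def]
  set ε : ℝ≥0 := min (1 / (k + 1)) (Real.toNNReal ((1 - (τ : ℝ)⁻¹) * a)) with hε
  have hε0 : 0 < ε := lt_min (by positivity)
    (Real.toNNReal_pos.2 (mul_pos (by linarith) ha))
  have hεk : (ε : ℝ) ≤ 1 / (k + 1) := by
    have : ε ≤ 1 / (k + 1) := min_le_left _ _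
    exact_mod_cast this
  have hεa : (ε : ℝ) ≤ (1 - (τ : ℝ)⁻¹) * a := by
    have h1 : ε ≤ Real.toNNReal ((1 - (τ : ℝ)⁻¹) * a) := min_le_right _ _
    rwa [Real.le_toNNReal_iff_coe_le (mul_nonneg (by linarith) ha.le)] at h1
  refine ⟨ε, hε0, M, τ⁻¹ • q, ?_, hk.le.trans (measure_mono fun v hv => ?_),
    ⟨(τ : ℝ)⁻¹ * a, by positivity, fun v => ?_⟩, fun v => ?_⟩
  · convert hτ
    rw [← volume_seminorm_le ha hqa hτ0'.le]
    congr 1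
    ext v
    simp only [mem_ofPred_eq]
    rw [hq', inv_mul_le_iff₀ hτ0', mul_one]
  · simp only [mem_ofPred_eq, add_apply, smul_apply, coe_normSeminorm,
      NNReal.smul_def, smul_eq_mul] at hv ⊢
    refine le_trans ?_ hv
    gcongr
    exact_mod_cast hεk
  · rw [hq', mul_assoc]
    exact mul_le_mul_of_nonneg_left (hqa v) (by positivity)
  · rw [hq']
    have h1 : (ε : ℝ) * ‖v‖ ≤ (1 - (τ : ℝ)⁻¹) * q v := by
      calc (ε : ℝ) * ‖v‖ ≤ (1 - (τ : ℝ)⁻¹) * a * ‖v‖ := by gcongr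
        _ = (1 - (τ : ℝ)⁻¹) * (a * ‖v‖) := by ring
        _ ≤ _ := mul_le_mul_of_nonneg_left (hqa v) (by linarith)
    linarith

end

/-! ### First order isometries on charts -/

/-- `f` is isometric to first order along `A` at every point of `A`. -/
def IsFirstOrderIsometryOn {X Y : Type*} [MetricSpace X] [MetricSpace Y] (f : X → Y)
    (A : Set X) : Prop :=
  ∀ x ∈ A, ∀ ε > 0, ∃ δ > 0, ∀ y ∈ A, dist y x < δ → (1 - ε) * dist y x ≤ dist (f y) (f x)

theorem HasMetricDerivWithin.mono {V Z : Type*} [NormedAddCommGroup V] [NormedSpace ℝ V]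
    [MetricSpace Z] {h : V → Z} {s : Seminorm ℝ V} {A A' : Set V} {x : V}
    (hA : HasMetricDerivWithin h s A x) (hAA' : A' ⊆ A) : HasMetricDerivWithin h s A' x := by
  intro ε hε
  obtain ⟨δ, hδ, h1⟩ := hA ε hε
  exact ⟨δ, hδ, fun y hy => h1 y (hAA' hy)⟩

section
variable {n : ℕ}

/-- Pairs of seminorms restricted to the unit ball live in a second countable space of continuous
functions, so by Lindelöf countably many of the given neighbourhoods cover `B`. -/
theorem volume_eq_zero_of_seminorm_locally_null {B : Set (EuclideanSpace ℝ (Fin n))}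
    {S S' : EuclideanSpace ℝ (Fin n) → Seminorm ℝ (EuclideanSpace ℝ (Fin n))}
    (hS : ∀ x ∈ B, Continuous (S x)) (hS' : ∀ x ∈ B, Continuous (S' x))
    (h : ∀ x ∈ B, ∃ ε > 0, volume {y ∈ B | (∀ v, |S y v - S x v| ≤ ε * ‖v‖) ∧
      ∀ v, |S' y v - S' x v| ≤ ε * ‖v‖} = 0) : volume B = 0 := by
  let K := closedBall (0 : EuclideanSpace ℝ (Fin n)) 1
  let Φ : B → C(K, ℝ) × C(K, ℝ) := fun x =>
    (⟨fun v => S x v, (hS x x.2).comp continuous_subtype_val⟩,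
      ⟨fun v => S' x v, (hS' x x.2).comp continuous_subtype_val⟩)
  choose! ε hε h0 using h
  obtain ⟨T, hTc, hT⟩ := TopologicalSpace.isOpen_iUnion_countable
    (fun x : B => ball (Φ x) (ε x)) fun x => isOpen_ball
  have homog : ∀ {p q : Seminorm ℝ (EuclideanSpace ℝ (Fin n))} {e : ℝ}, 
      (∀ v ∈ K, |p v - q v| ≤ e) → ∀ v, |p v - q v| ≤ e * ‖v‖ := by
    intro p q e hpq v
    rcases eq_or_ne v 0 with rfl | hv
    · simp
    have hv' := norm_pos_iff.2 hv
    have h1 := hpq (‖v‖⁻¹ • v) (by simp [K, norm_smul, hv'.ne'])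
    rw [map_smul_eq_mul, map_smul_eq_mul, ← mul_sub, norm_inv, norm_norm, abs_mul,
      abs_of_pos (inv_pos.2 hv'), inv_mul_le_iff₀ hv', mul_comm] at h1
    exact h1
  refine measure_mono_null (t := ⋃ x ∈ T, {y ∈ B | (∀ v, |S y v - S x v| ≤ ε x * ‖v‖) ∧
      ∀ v, |S' y v - S' x v| ≤ ε x * ‖v‖}) (fun y hy => ?_)
    ((measure_biUnion_null_iff hTc).2 fun x _ => h0 x x.2)
  have hy1 : Φ ⟨y, hy⟩ ∈ ⋃ x ∈ T, ball (Φ x) (ε x) := by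
    rw [hT]
    exact mem_iUnion.2 ⟨⟨y, hy⟩, mem_ball_self (hε y hy)⟩
  obtain ⟨x, hxT, hx⟩ := mem_iUnion₂.1 hy1
  rw [mem_ball, Prod.dist_eq, max_lt_iff] at hx
  refine mem_iUnion₂.2 ⟨x, hxT, hy, homog fun v hv => ?_, homog fun v hv => ?_⟩
  · exact (ContinuousMap.dist_apply_le_dist (f := (Φ ⟨y, hy⟩).1) (g := (Φ x).1) ⟨v, hv⟩).trans hx.1.le
  · exact (ContinuousMap.dist_apply_le_dist (f := (Φ ⟨y, hy⟩).2) (g := (Φ x).2) ⟨v, hv⟩).trans hx.2.le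

/-- The unit ball of `S x` has infinite volume, so for each `M` a small multiple of the norm can be
added while keeping volume at least `M`. On bounded pieces the covering estimate then holds with
every `M`. -/
theorem hausdorffMeasure_image_eq_zero_of_degenerate {X : Type*} [MetricSpace X]
    [MeasurableSpace X] [BorelSpace X] {g : EuclideanSpace ℝ (Fin n) → X} {C : ℝ≥0}
    {D : Set (EuclideanSpace ℝ (Fin n))} (hg : LipschitzOnWith C g D)
    {S : EuclideanSpace ℝ (Fin n) → Seminorm ℝ (EuclideanSpace ℝ (Fin n))}
    (hS : ∀ x ∈ D, ∀ v, S x v ≤ C * ‖v‖) (hgS : ∀ x ∈ D, HasMetricDerivWithin g (S x) D x)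
    (hdeg : ∀ x ∈ D, ¬ ∃ a > 0, ∀ v, a * ‖v‖ ≤ S x v) : μH[n] (g '' D) = 0 := by
  suffices H : ∀ R : ℕ, μH[n] (g '' (D ∩ ball 0 R)) = 0 by
    refine measure_mono_null (t := ⋃ R : ℕ, g '' (D ∩ ball 0 R)) ?_ (measure_iUnion_null H)
    rw [← image_iUnion, ← inter_iUnion, iUnion_ball_nat, inter_univ]
  intro R
  set A := D ∩ ball (0 : EuclideanSpace ℝ (Fin n)) R with hA
  have hAD : A ⊆ D := inter_subset_left
  have hAfin : volume A ≠ ∞ :=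
    ne_top_of_le_ne_top measure_ball_lt_top.ne (measure_mono inter_subset_right)
  set N := normSeminorm ℝ (EuclideanSpace ℝ (Fin n)) with hN
  have hadd : ∀ (p : Seminorm ℝ (EuclideanSpace ℝ (Fin n))) (e : ℝ≥0) v,
      (p + e • N) v = p v + e * ‖v‖ := fun p e v => by
    simp [hN, NNReal.smul_def]
  have key : ∀ M : ℝ≥0, M * μH[n] (g '' A) ≤ 2 ^ n * volume A := by
    intro M
    let T : ℕ → Set (EuclideanSpace ℝ (Fin n)) := fun k =>
      {x ∈ A | M ≤ volume {v | (S x + (1 / (k + 1 : ℝ≥0)) • N) v ≤ 1}}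
    have hTmono : Monotone T := by
      refine fun k l hkl x hx => ⟨hx.1, hx.2.trans (measure_mono fun v hv => ?_)⟩
      simp only [mem_ofPred_eq, hadd] at hv ⊢
      refine le_trans ?_ hv
      have : (1 / (l + 1 : ℝ≥0)) ≤ 1 / (k + 1 : ℝ≥0) := by gcongr
      gcongr
    have hTU : A ⊆ ⋃ k, T k := by
      intro x hx
      have hc := continuous_seminorm_of_le (hS x (hAD hx))
      obtain ⟨v, hv, hpv⟩ := exists_seminorm_eq_zero hc (hdeg x (hAD hx))
      obtain ⟨k, hk⟩ := exists_lt_volume_add_smul_norm_le (p := S x) (c := M)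
        (by rw [volume_seminorm_lt_one_eq_top hc hv hpv]; simp)
      exact mem_iUnion.2 ⟨k, hx, hk.le⟩
    have hTb : ∀ k, M * μH[n] (g '' T k) ≤ 2 ^ n * volume A := by
      intro k
      have hTD : T k ⊆ D := fun x hx => hAD hx.1
      have hk0 : (0 : ℝ) < (1 / (k + 1 : ℝ≥0) : ℝ≥0) := by positivity
      refine (mul_hausdorffMeasure_image_le (hg.mono hTD)
        (p := fun x => S x + (1 / (k + 1 : ℝ≥0)) • N) (a := (1 / (k + 1 : ℝ≥0) : ℝ≥0))
        (b := C + (1 / (k + 1 : ℝ≥0) : ℝ≥0)) hk0 (by positivity) (fun x hx v => ?_)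
        (fun x hx v => ?_) (fun x hx => hx.2) fun x hx => ?_).trans ?_
      · rw [hadd]; linarith [apply_nonneg (S x) v]
      · rw [hadd, add_mul]; linarith [hS x (hTD hx) v]
      · obtain ⟨δ, hδ, h1⟩ := hgS x (hTD hx) _ hk0
        refine ⟨δ, hδ, fun y hy hyx => ?_⟩
        rw [hadd]
        linarith [(abs_le.1 (h1 y (hTD hy) hyx)).2]
      · gcongr
        exact fun x hx => hx.1
    have h2 : g '' A ⊆ ⋃ k, g '' T k := by
      rw [← image_iUnion]; exact image_mono hTU
    calc M * μH[n] (g '' A) ≤ M * μH[n] (⋃ k, g '' T k) := by gcongr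
      _ = ⨆ k, M * μH[n] (g '' T k) := by
          rw [Monotone.measure_iUnion fun k l hkl => image_mono (hTmono hkl), ENNReal.mul_iSup]
      _ ≤ _ := iSup_le hTb
  by_contra hne
  have hfin : (2 : ℝ≥0∞) ^ n * volume A ≠ ∞ := ENNReal.mul_ne_top (by simp) hAfin
  obtain ⟨k, hk⟩ := ENNReal.exists_nat_mul_gt hne hfin
  exact absurd (key k) (not_le.2 (by simpa using hk))

/-- On a small piece `A` where the seminorms are almost constant, the lower estimate for `g`, `hvol`
and the upper estimate for `f ∘ g` give `M * H ≤ 2 ^ n * volume A ≤ volume {q ≤ 1} * H` with `volume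
{q ≤ 1} < M` and `H` finite. So `H = 0`, and `A` is null. -/
theorem volume_eq_zero_of_seminorm_ne {X Y : Type*} [MetricSpace X] [MeasurableSpace X]
    [BorelSpace X] [MetricSpace Y] [MeasurableSpace Y] [BorelSpace Y] {f : X → Y}
    (hvol : ∀ A : Set X, μH[n] A ≤ μH[n] (f '' A))
    {g : EuclideanSpace ℝ (Fin n) → X} {C : ℝ≥0} {B : Set (EuclideanSpace ℝ (Fin n))}
    (hfg : LipschitzOnWith C (f ∘ g) B)
    {S S' : EuclideanSpace ℝ (Fin n) → Seminorm ℝ (EuclideanSpace ℝ (Fin n))}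
    (hS : ∀ x ∈ B, ∀ v, S x v ≤ C * ‖v‖) (hS' : ∀ x ∈ B, ∀ v, S' x v ≤ S x v)
    (hgS : ∀ x ∈ B, HasMetricDerivWithin g (S x) B x)
    (hfgS : ∀ x ∈ B, HasMetricDerivWithin (f ∘ g) (S' x) B x)
    (hnd : ∀ x ∈ B, ∃ a > 0, ∀ v, a * ‖v‖ ≤ S x v)
    (hne : ∀ x ∈ B, ∃ v, S' x v ≠ S x v) : volume B = 0 := by
  have hSc : ∀ x ∈ B, Continuous (S x) := fun x hx => continuous_seminorm_of_le (hS x hx)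
  have hSc' : ∀ x ∈ B, Continuous (S' x) := fun x hx =>
    continuous_seminorm_of_le fun v => (hS' x hx v).trans (hS x hx v)
  refine volume_eq_zero_of_seminorm_locally_null hSc hSc' fun x₀ hx₀ => ?_
  obtain ⟨a, ha, haS⟩ := hnd x₀ hx₀
  obtain ⟨v, hv⟩ := hne x₀ hx₀
  obtain ⟨ε, hε, M, q, hqM, hMp, ⟨a', ha', hqa⟩, hqS⟩ :=
    exists_seminorm_gap (hSc' x₀ hx₀) (hSc x₀ hx₀) ha haS (hS' x₀ hx₀) hv
  have hε' : (0 : ℝ) < ε := hε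
  refine ⟨ε / 2, by positivity, ?_⟩
  set B₀ := {y ∈ B | (∀ v, |S y v - S x₀ v| ≤ ε / 2 * ‖v‖) ∧
    ∀ v, |S' y v - S' x₀ v| ≤ ε / 2 * ‖v‖} with hB₀
  let T : ℕ → Set (EuclideanSpace ℝ (Fin n)) := fun k =>
    {x ∈ B₀ | ∀ y ∈ B, ‖y - x‖ < 1 / (k + 1 : ℝ) →
      |dist (g y) (g x) - S x (y - x)| ≤ ε / 2 * ‖y - x‖}
  have hTU : B₀ ⊆ ⋃ k, T k := by
    intro x hx
    obtain ⟨δ, hδ, h1⟩ := hgS x hx.1 (ε / 2) (by positivity)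
    obtain ⟨k, hk⟩ := exists_nat_one_div_lt hδ
    exact mem_iUnion.2 ⟨k, hx, fun y hy hyx => h1 y hy (hyx.trans hk)⟩
  refine measure_mono_null hTU (measure_iUnion_null fun k => ?_)
  refine measure_null_of_locally_null _ fun z hz => ?_
  refine ⟨T k ∩ ball z (1 / (2 * (k + 1 : ℝ))),
    inter_mem_nhdsWithin _ (ball_mem_nhds _ (by positivity)), ?_⟩
  set A := T k ∩ ball z (1 / (2 * (k + 1 : ℝ))) with hA
  have hAB : A ⊆ B := fun x hx => hx.1.1.1
  have hqC : ∀ v, q v ≤ C * ‖v‖ := fun v => by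
    have := hqS v
    have := hS x₀ hx₀ v
    have : 0 ≤ ε * ‖v‖ := by positivity
    linarith
  set N := normSeminorm ℝ (EuclideanSpace ℝ (Fin n)) with hN
  have hadd : ∀ v, (S' x₀ + ε • N) v = S' x₀ v + ε * ‖v‖ := fun v => by
    simp [hN, NNReal.smul_def]
  have lower := volume_le_mul_hausdorffMeasure_image (g := g) (A := A)
    (continuous_seminorm_of_le hqC) ha' hqa (fun y hy x hx => by
      have hyx : ‖y - x‖ < 1 / (k + 1 : ℝ) := by
        have h1 := hy.2
        have h2 := hx.2
        rw [mem_ball] at h1 h2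
        have h3 := dist_triangle_right y x z
        rw [dist_eq_norm] at h3
        have h4 : 1 / (2 * (k + 1 : ℝ)) + 1 / (2 * (k + 1 : ℝ)) = 1 / (k + 1 : ℝ) := by
          field_simp; norm_num
        linarith
      have h1 := (abs_le.1 (hx.1.2 y (hAB hy) hyx)).1
      have h2 := (abs_le.1 (hx.1.1.2.1 (y - x))).1
      have h3 := hqS (y - x)
      linarith)
  have upper := mul_hausdorffMeasure_image_le (h := f ∘ g) (A := A) (hfg.mono hAB)
    (p := fun _ => S' x₀ + ε • N) (a := ε) (b := C + ε) hε' (by positivity)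
    (fun x hx v => by rw [hadd]; linarith [apply_nonneg (S' x₀) v])
    (fun x hx v => by rw [hadd, add_mul]; linarith [hS x₀ hx₀ v, hS' x₀ hx₀ v])
    (M := M) (fun x hx => hMp) fun x hx => by
      obtain ⟨δ, hδ, h1⟩ := hfgS x (hAB hx) (ε / 2) (by positivity)
      refine ⟨δ, hδ, fun y hy hyx => ?_⟩
      rw [hadd]
      have h2 := (abs_le.1 (h1 y (hAB hy) hyx)).2
      have h3 := (abs_le.1 (hx.1.1.2.2 (y - x))).2
      linarith
  rw [image_comp] at upper
  have hAfin : volume A ≠ ∞ :=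
    ne_top_of_le_ne_top measure_ball_lt_top.ne (measure_mono inter_subset_right)
  set H := μH[n] (f '' (g '' A))
  have hle : 2 ^ n * volume A ≤ volume {v | q v ≤ 1} * H :=
    lower.trans (by gcongr; exact hvol _)
  have hM0 : (M : ℝ≥0∞) ≠ 0 := (zero_le.trans_lt hqM).ne'
  have hHfin : H ≠ ∞ := by
    intro h
    rw [h, ENNReal.mul_top hM0] at upper
    exact ENNReal.mul_ne_top (by simp) hAfin (top_le_iff.1 upper)
  have hH0 : H = 0 := by
    by_contra h0
    exact absurd (upper.trans hle) (not_le.2 ((ENNReal.mul_lt_mul_iff_left h0 hHfin).2 hqM))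
  rw [hH0, mul_zero, nonpos_iff_eq_zero, mul_eq_zero] at hle
  exact hle.resolve_left (by simp)

theorem isFirstOrderIsometryOn_image {X Y : Type*} [MetricSpace X] [MetricSpace Y] {f : X → Y}
    {g : EuclideanSpace ℝ (Fin n) → X} {R : Set (EuclideanSpace ℝ (Fin n))} {c : ℝ} (hc : 0 < c)
    (hR : ∀ x ∈ R, ∀ y ∈ R, ‖y - x‖ ≤ c * dist (g y) (g x))
    {S : EuclideanSpace ℝ (Fin n) → Seminorm ℝ (EuclideanSpace ℝ (Fin n))}
    (hgS : ∀ x ∈ R, HasMetricDerivWithin g (S x) R x)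
    (hfgS : ∀ x ∈ R, HasMetricDerivWithin (f ∘ g) (S x) R x) :
    IsFirstOrderIsometryOn f (g '' R) := by
  rintro _ ⟨x, hx, rfl⟩ ε hε
  obtain ⟨δ₁, hδ₁, h1⟩ := hgS x hx (ε / (2 * c)) (by positivity)
  obtain ⟨δ₂, hδ₂, h2⟩ := hfgS x hx (ε / (2 * c)) (by positivity)
  refine ⟨min δ₁ δ₂ / c, by positivity, ?_⟩
  rintro _ ⟨y, hy, rfl⟩ hyx
  rw [lt_div_iff₀ hc, mul_comm] at hyx
  have h3 := hR x hx y hy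
  have h4 := (abs_le.1 (h1 y hy (h3.trans_lt (hyx.trans_le (min_le_left _ _))))).2
  have h5 := (abs_le.1 (h2 y hy (h3.trans_lt (hyx.trans_le (min_le_right _ _))))).1
  have h6 : ε / (2 * c) * ‖y - x‖ ≤ ε / 2 * dist (g y) (g x) := by
    calc _ ≤ ε / (2 * c) * (c * dist (g y) (g x)) := by gcongr
      _ = _ := by field_simp
  simp only [Function.comp_apply] at h5
  linarith

theorem exists_isFirstOrderIsometryOn_chart {X Y : Type*} [MetricSpace X] [MeasurableSpace X]
    [BorelSpace X] [MetricSpace Y] [MeasurableSpace Y] [BorelSpace Y] {f : X → Y}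
    (hf : LipschitzWith 1 f) (hvol : ∀ A : Set X, μH[n] A ≤ μH[n] (f '' A))
    {g : EuclideanSpace ℝ (Fin n) → X} {C : ℝ≥0} {E : Set (EuclideanSpace ℝ (Fin n))}
    (hg : LipschitzOnWith C g E) :
    ∃ A : ℕ × ℕ → Set X, (∀ i, IsFirstOrderIsometryOn f (A i)) ∧
      μH[n] (g '' E \ ⋃ i, A i) = 0 := by
  have hfg : LipschitzOnWith C (f ∘ g) E := by
    simpa using hf.comp_lipschitzOnWith hg
  set G := {x ∈ E | ∃ p : Seminorm ℝ (EuclideanSpace ℝ (Fin n)) ×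
    Seminorm ℝ (EuclideanSpace ℝ (Fin n)), (∀ v, p.1 v ≤ C * ‖v‖) ∧ (∀ v, p.2 v ≤ p.1 v) ∧
      HasMetricDerivWithin g p.1 E x ∧ HasMetricDerivWithin (f ∘ g) p.2 E x} with hG
  have hG0 : volume (E \ G) = 0 := by
    have : ∀ᵐ x : EuclideanSpace ℝ (Fin n), x ∈ E → x ∈ G := by
      filter_upwards [ae_exists_hasMetricDerivWithin volume hg,
        ae_exists_hasMetricDerivWithin volume hfg] with x h1 h2 hx
      obtain ⟨s, hsC, hs⟩ := h1 hx
      obtain ⟨s', hsC', hs'⟩ := h2 hx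
      -- Metric derivatives along `E` need not be unique, so `s' ≤ s` is not automatic. Since `f` is
      -- 1-Lipschitz, `s ⊔ s'` is again a metric derivative of `g`.
      refine ⟨hx, (s ⊔ s', s'), fun v => ?_, fun v => ?_, fun ε hε => ?_, hs'⟩
      · rw [Seminorm.sup_apply]; exact max_le (hsC v) (hsC' v)
      · rw [Seminorm.sup_apply]; exact le_max_right _ _
      · obtain ⟨δ₁, hδ₁, h1⟩ := hs ε hε
        obtain ⟨δ₂, hδ₂, h2⟩ := hs' ε hε
        refine ⟨min δ₁ δ₂, lt_min hδ₁ hδ₂, fun y hy hyx => ?_⟩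
        have h3 := abs_le.1 (h1 y hy (hyx.trans_le (min_le_left _ _)))
        have h4 := abs_le.1 (h2 y hy (hyx.trans_le (min_le_right _ _)))
        have h5 : dist ((f ∘ g) y) ((f ∘ g) x) ≤ dist (g y) (g x) := by
          simpa using hf.dist_le_mul (g y) (g x)
        rw [Seminorm.sup_apply, abs_le]
        refine ⟨?_, ?_⟩
        · rcases max_cases (s (y - x)) (s' (y - x)) with h | h <;> linarith
        · linarith [le_max_left (s (y - x)) (s' (y - x))]
    rw [ae_iff] at this
    convert this using 2
    ext x; simp
  have hGE : G ⊆ E := fun x hx => hx.1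
  choose! P hPC hPle hPg hPfg using fun x (hx : x ∈ G) => hx.2
  set D := {x ∈ G | ¬ ∃ a > 0, ∀ v, a * ‖v‖ ≤ (P x).1 v} with hD
  set B := {x ∈ G | (∃ a > 0, ∀ v, a * ‖v‖ ≤ (P x).1 v) ∧ ∃ v, (P x).2 v ≠ (P x).1 v} with hB
  set R := {x ∈ G | (∃ a > 0, ∀ v, a * ‖v‖ ≤ (P x).1 v) ∧ (P x).2 = (P x).1} with hR
  have hDG : D ⊆ G := sep_subset _ _
  have hBG : B ⊆ G := sep_subset _ _
  have hRG : R ⊆ G := sep_subset _ _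
  have hD0 : μH[n] (g '' D) = 0 :=
    hausdorffMeasure_image_eq_zero_of_degenerate (hg.mono (hDG.trans hGE)) (S := fun x => (P x).1)
      (fun x hx => hPC x (hDG hx)) (fun x hx => (hPg x (hDG hx)).mono (hDG.trans hGE))
      fun x hx => hx.2
  have hB0 : volume B = 0 :=
    volume_eq_zero_of_seminorm_ne hvol (hfg.mono (hBG.trans hGE)) (S := fun x => (P x).1)
      (S' := fun x => (P x).2) (fun x hx => hPC x (hBG hx)) (fun x hx => hPle x (hBG hx))
      (fun x hx => (hPg x (hBG hx)).mono (hBG.trans hGE))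
      (fun x hx => (hPfg x (hBG hx)).mono (hBG.trans hGE)) (fun x hx => hx.2.1) fun x hx => hx.2.2
  let c := TopologicalSpace.denseSeq (EuclideanSpace ℝ (Fin n))
  -- On each piece `g` has a Lipschitz inverse: the first index fixes the scale and constant, the
  -- second a small ball in which any two points are within that scale.
  let T : ℕ × ℕ → Set (EuclideanSpace ℝ (Fin n)) := fun i =>
    {x ∈ R | ∀ y ∈ E, ‖y - x‖ < 1 / (i.1 + 1 : ℝ) → ‖y - x‖ ≤ (i.1 + 1) * dist (g y) (g x)} ∩
      ball (c i.2) (1 / (2 * (i.1 + 1 : ℝ)))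
  have hTR : ∀ i, T i ⊆ R := fun i x hx => hx.1.1
  have hRT : R ⊆ ⋃ i, T i := by
    intro x hx
    obtain ⟨a, ha, haP⟩ := hx.2.1
    obtain ⟨δ, hδ, h1⟩ := hPg x (hRG hx) (a / 2) (by positivity)
    obtain ⟨k, hk⟩ := exists_nat_one_div_lt (show 0 < min δ (a / 2) by positivity)
    obtain ⟨j, hj⟩ := (TopologicalSpace.denseRange_denseSeq
      (EuclideanSpace ℝ (Fin n))).exists_dist_lt x (show 0 < 1 / (2 * (k + 1 : ℝ)) by positivity)
    refine mem_iUnion.2 ⟨(k, j), ⟨hx, fun y hy hyx => ?_⟩, hj⟩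
    have h2 := (abs_le.1 (h1 y hy (hyx.trans (hk.trans_le (min_le_left _ _))))).1
    have h3 := haP (y - x)
    have h4 : 1 / (k + 1 : ℝ) * ‖y - x‖ ≤ dist (g y) (g x) := by
      have : 1 / (k + 1 : ℝ) * ‖y - x‖ ≤ a / 2 * ‖y - x‖ := by
        exact mul_le_mul_of_nonneg_right (hk.trans_le (min_le_right _ _)).le (norm_nonneg _)
      linarith
    rwa [one_div, inv_mul_le_iff₀ (by positivity)] at h4
  refine ⟨fun i => g '' T i, fun i => ?_, ?_⟩
  · refine isFirstOrderIsometryOn_image (c := i.1 + 1) (by positivity) (fun x hx y hy => ?_)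
      (S := fun x => (P x).1) (fun x hx => ?_) fun x hx => ?_
    · refine hx.1.2 y (hGE (hRG (hTR i hy))) ?_
      have h1 := hy.2
      have h2 := hx.2
      rw [mem_ball] at h1 h2
      have h3 := dist_triangle_right y x (c i.2)
      rw [dist_eq_norm] at h3
      have h4 : 1 / (2 * (i.1 + 1 : ℝ)) + 1 / (2 * (i.1 + 1 : ℝ)) = 1 / (i.1 + 1 : ℝ) := by
        field_simp; norm_num
      linarith
    · exact (hPg x (hRG (hTR i hx))).mono ((hTR i).trans (hRG.trans hGE))
    · rw [← (hTR i hx).2.2]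
      exact (hPfg x (hRG (hTR i hx))).mono ((hTR i).trans (hRG.trans hGE))
  · refine measure_mono_null (t := g '' (E \ G) ∪ (g '' D ∪ g '' B)) ?_ (measure_union_null
      (hausdorffMeasure_image_null (hg.mono sdiff_subset) hG0) (measure_union_null hD0
        (hausdorffMeasure_image_null (hg.mono (hBG.trans hGE)) hB0)))
    rintro _ ⟨⟨x, hx, rfl⟩, hxA⟩
    by_cases hxG : x ∈ G
    swap
    · exact Or.inl ⟨x, ⟨hx, hxG⟩, rfl⟩
    by_cases hxa : ∃ a > 0, ∀ v, a * ‖v‖ ≤ (P x).1 v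
    swap
    · exact Or.inr (Or.inl ⟨x, ⟨hxG, hxa⟩, rfl⟩)
    by_cases hxv : ∃ v, (P x).2 v ≠ (P x).1 v
    · exact Or.inr (Or.inr ⟨x, ⟨hxG, hxa, hxv⟩, rfl⟩)
    · push Not at hxv
      refine absurd ?_ hxA
      rw [← image_iUnion]
      exact mem_image_of_mem g (hRT ⟨hxG, hxa, Seminorm.ext hxv⟩)

end

/-! ### Lengths of curves -/

/-- The isolated points of `T` form a locally null set. This replaces Lebesgue density, so `T` may
be nonmeasurable. -/
theorem ae_nhdsWithin_sdiff_neBot (T : Set ℝ) : ∀ᵐ t, t ∈ T → (𝓝[T \ {t}] t).NeBot := by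
  have h : volume {t ∈ T | ¬ (𝓝[T \ {t}] t).NeBot} = 0 := by
    refine measure_null_of_locally_null _ fun t ht => ?_
    have h1 : 𝓝[T \ {t}] t = ⊥ := not_neBot.1 ht.2
    rw [← empty_mem_iff_bot, mem_nhdsWithin] at h1
    obtain ⟨u, hu, htu, hu'⟩ := h1
    refine ⟨_, inter_mem_nhdsWithin _ (hu.mem_nhds htu), measure_mono_null (t := {t}) ?_ (by simp)⟩
    intro x hx
    by_contra hxt
    exact hu' ⟨hx.2, hx.1.1, hxt⟩
  rw [ae_iff]
  convert h using 2
  ext t; simp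

theorem eVariationOn_le_of_edist_le {α E F : Type*} [LinearOrder α] [PseudoEMetricSpace E]
    [PseudoEMetricSpace F] {φ : α → E} {ψ : α → F} {s : Set α}
    (h : ∀ x ∈ s, ∀ y ∈ s, x ≤ y → edist (φ y) (φ x) ≤ edist (ψ y) (ψ x)) :
    eVariationOn φ s ≤ eVariationOn ψ s := by
  refine iSup_le fun ⟨k, u, hu, us⟩ => ?_
  exact (Finset.sum_le_sum fun i _ => h _ (us i) _ (us (i + 1)) (hu i.le_succ)).trans
    (eVariationOn.sum_le hu us)

theorem absolutelyContinuousOnInterval_dist {X : Type*} [MetricSpace X] {γ : ℝ → X} {a b : ℝ}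
    (hγ : AbsolutelyContinuousOnInterval γ a b) (x : X) :
    AbsolutelyContinuousOnInterval (fun t => dist (γ t) x) a b := by
  rw [absolutelyContinuousOnInterval_iff] at hγ ⊢
  intro ε hε
  obtain ⟨δ, hδ, h⟩ := hγ ε hε
  exact ⟨δ, hδ, fun E hE hEδ => (Finset.sum_le_sum fun i _ => abs_dist_sub_le _ _ _).trans_lt
    (h E hE hEδ)⟩

/-- Kuratowski embedding; it carries the bounded variation of absolutely continuous curves over from
normed spaces. -/
theorem exists_isometry_boundedContinuousFunction (X : Type*) [MetricSpace X] :
    ∃ Φ : X → BoundedContinuousFunction X ℝ, Isometry Φ := by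
  rcases isEmpty_or_nonempty X with hX | ⟨⟨x₀⟩⟩
  · exact ⟨fun x => (hX.false x).elim, fun x => (hX.false x).elim⟩
  let Φ : X → BoundedContinuousFunction X ℝ := fun x =>
    BoundedContinuousFunction.ofNormedAddCommGroup (fun y => dist x y - dist x₀ y)
      (by fun_prop) (dist x x₀) fun y => abs_dist_sub_le _ _ _
  refine ⟨Φ, Isometry.of_dist_eq fun x y => le_antisymm ?_ ?_⟩
  · refine (BoundedContinuousFunction.dist_le dist_nonneg).2 fun z => ?_
    simpa [Φ, Real.dist_eq] using abs_dist_sub_le x y z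
  · have h := BoundedContinuousFunction.dist_coe_le_dist (f := Φ x) (g := Φ y) y
    simpa [Φ, Real.dist_eq] using h

theorem boundedVariationOn_of_absolutelyContinuousOnInterval {X : Type*} [MetricSpace X]
    {γ : ℝ → X} {a b : ℝ} (hγ : AbsolutelyContinuousOnInterval γ a b) :
    BoundedVariationOn γ (uIcc a b) := by
  obtain ⟨Φ, hΦ⟩ := exists_isometry_boundedContinuousFunction X
  have h : AbsolutelyContinuousOnInterval (Φ ∘ γ) a b := by
    rw [absolutelyContinuousOnInterval_iff] at hγ ⊢
    simpa only [Function.comp_apply, hΦ.dist_eq] using hγ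
  have h1 := h.boundedVariationOn
  rw [BoundedVariationOn, ← lt_top_iff_ne_top] at h1 ⊢
  refine (eVariationOn_le_of_edist_le fun x _ y _ _ => ?_).trans_lt h1
  rw [Function.comp_apply, Function.comp_apply, hΦ.edist_eq]

theorem continuousOn_of_absolutelyContinuousOnInterval {X : Type*} [MetricSpace X]
    {γ : ℝ → X} {a b : ℝ} (hγ : AbsolutelyContinuousOnInterval γ a b) :
    ContinuousOn γ (uIcc a b) := by
  intro x hx
  have h := (absolutelyContinuousOnInterval_dist hγ (γ x)).continuousOn x hx
  rw [ContinuousWithinAt, dist_self] at h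
  exact tendsto_iff_dist_tendsto_zero.2 h

section
variable {X Y : Type*} [MetricSpace X] [MetricSpace Y]

/-- Both derivatives exist, so they may be computed along times in `γ ⁻¹' A` tending to `t`; there
the slopes compare up to a factor `1 - ε`. -/
theorem deriv_dist_le_deriv_of_isFirstOrderIsometryOn {f : X → Y} {A : Set X}
    (hA : IsFirstOrderIsometryOn f A) {γ : ℝ → X} {w : ℝ → ℝ} {a b t : ℝ} (ht : t ∈ Ioo a b)
    (hγ : ContinuousAt γ t) (htA : γ t ∈ A) (hacc : (𝓝[γ ⁻¹' A \ {t}] t).NeBot)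
    (hfw : ∀ x ∈ Icc a b, ∀ y ∈ Icc a b, x ≤ y → dist (f (γ y)) (f (γ x)) ≤ w y - w x)
    (hdw : DifferentiableAt ℝ w t) {x : X} (hdu : DifferentiableAt ℝ (fun t => dist (γ t) x) t) :
    deriv (fun t => dist (γ t) x) t ≤ deriv w t := by
  set u := fun t => dist (γ t) x
  have hle : 𝓝[γ ⁻¹' A \ {t}] t ≤ 𝓝[≠] t := nhdsWithin_mono _ fun y hy => hy.2
  have hu' := (hasDerivAt_iff_tendsto_slope.1 hdu.hasDerivAt).mono_left hle
  have hw' := (hasDerivAt_iff_tendsto_slope.1 hdw.hasDerivAt).mono_left hle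
  have hε : ∀ ε ∈ Ioo (0 : ℝ) 1, (1 - ε) * deriv u t ≤ deriv w t := by
    intro ε hε
    obtain ⟨δ, hδ, h⟩ := hA _ htA ε hε.1
    refine le_of_tendsto_of_tendsto (hu'.const_mul (1 - ε)) hw' ?_
    filter_upwards [self_mem_nhdsWithin, mem_nhdsWithin_of_mem_nhds (Icc_mem_nhds ht.1 ht.2),
      mem_nhdsWithin_of_mem_nhds (hγ.preimage_mem_nhds (ball_mem_nhds _ hδ))] with y hy hyI hyδ
    have h1 := h (γ y) hy.1 hyδ
    have h2 : u y - u t ≤ dist (γ y) (γ t) := (le_abs_self _).trans (abs_dist_sub_le _ _ _)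
    have h3 : u t - u y ≤ dist (γ y) (γ t) := by
      rw [dist_comm (γ y)]; exact (le_abs_self _).trans (abs_dist_sub_le _ _ _)
    have htI := Ioo_subset_Icc_self ht
    have h0 : (0 : ℝ) ≤ 1 - ε := by linarith [hε.2]
    rw [slope_def_field, slope_def_field]
    rcases lt_or_gt_of_ne (show y ≠ t from hy.2) with hyt | hyt
    · have h4 := hfw y hyI t htI hyt.le
      rw [dist_comm] at h4
      rw [← mul_div_assoc, ← neg_div_neg_eq, ← neg_div_neg_eq (w y - w t)]
      refine div_le_div_of_nonneg_right ?_ (by linarith)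
      have := mul_le_mul_of_nonneg_left h3 h0
      linarith
    · have h4 := hfw t htI y hyI hyt.le
      rw [← mul_div_assoc]
      refine div_le_div_of_nonneg_right ?_ (by linarith)
      have := mul_le_mul_of_nonneg_left h2 h0
      linarith
  have hlim : Tendsto (fun ε : ℝ => (1 - ε) * deriv u t) (𝓝[>] 0) (𝓝 ((1 - 0) * deriv u t)) :=
    ((tendsto_const_nhds.sub tendsto_id).mul_const _).mono_left nhdsWithin_le_nhds
  rw [sub_zero, one_mul] at hlim
  exact le_of_tendsto hlim (mem_of_superset (Ioo_mem_nhdsGT one_pos) hε)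

theorem eVariationOn_le_eVariationOn_comp {f : X → Y} (hf : LipschitzWith 1 f) {ι : Type*}
    [Countable ι] {A : ι → Set X} (hA : ∀ i, IsFirstOrderIsometryOn f (A i)) {γ : ℝ → X} {a b : ℝ}
    (hab : a ≤ b) (hγ : AbsolutelyContinuousOnInterval γ a b)
    (hγA : ∀ᵐ t, t ∈ Icc a b → γ t ∈ ⋃ i, A i) :
    eVariationOn γ (Icc a b) ≤ eVariationOn (f ∘ γ) (Icc a b) := by
  have hbv : BoundedVariationOn (f ∘ γ) (Icc a b) := by
    have h1 := boundedVariationOn_of_absolutelyContinuousOnInterval hγ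
    rw [uIcc_of_le hab] at h1
    exact hf.comp_boundedVariationOn h1
  have hlbv := hbv.locallyBoundedVariationOn
  have haI : a ∈ Icc a b := left_mem_Icc.2 hab
  set w := variationOnFromTo (f ∘ γ) (Icc a b) a
  have hwm : MonotoneOn w (Icc a b) := variationOnFromTo.monotoneOn hlbv haI
  have hwsub : ∀ x ∈ Icc a b, ∀ y ∈ Icc a b, w y - w x =
      variationOnFromTo (f ∘ γ) (Icc a b) x y := fun x hx y hy =>
    variationOnFromTo.sub_right hlbv haI hy hx
  have hfw : ∀ x ∈ Icc a b, ∀ y ∈ Icc a b, x ≤ y → dist (f (γ y)) (f (γ x)) ≤ w y - w x := by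
    intro x hx y hy hxy
    rw [hwsub x hx y hy, variationOnFromTo.eq_of_le _ _ hxy, dist_edist]
    exact ENNReal.toReal_mono (hlbv x y hx hy)
      (eVariationOn.edist_le _ ⟨hy, hxy, le_rfl⟩ ⟨hx, le_rfl, hxy⟩)
  have hγc : ContinuousOn γ (Icc a b) := by
    have := continuousOn_of_absolutelyContinuousOnInterval hγ
    rwa [uIcc_of_le hab] at this
  have hacc : ∀ᵐ t, ∀ i, t ∈ γ ⁻¹' A i → (𝓝[γ ⁻¹' A i \ {t}] t).NeBot :=
    ae_all_iff.2 fun i => ae_nhdsWithin_sdiff_neBot _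
  have key : ∀ x ∈ Icc a b, ∀ y ∈ Icc a b, x ≤ y → dist (γ y) (γ x) ≤ w y - w x := by
    intro x hx y hy hxy
    have hsub : Icc x y ⊆ Icc a b := Icc_subset_Icc hx.1 hy.2
    have huac : AbsolutelyContinuousOnInterval (fun t => dist (γ t) (γ x)) x y :=
      absolutelyContinuousOnInterval_dist
        (hγ.mono (by rw [uIcc_of_le hab, uIcc_of_le hxy]; exact hsub)) _
    have hwxy : MonotoneOn w (uIcc x y) := hwm.mono (by rwa [uIcc_of_le hxy])
    have h1 := huac.integral_deriv_eq_sub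
    rw [dist_self, sub_zero] at h1
    -- The monotone `w` need not be the integral of its derivative; only the bound of that integral
    -- by the increment is used.
    have h2 := hwxy.intervalIntegral_deriv_mem_uIcc
    rw [uIcc_of_le (sub_nonneg.2 (hwm hx hy hxy))] at h2
    rw [← h1]
    refine le_trans ?_ h2.2
    refine intervalIntegral.integral_mono_ae_restrict hxy huac.intervalIntegrable_deriv
      hwxy.intervalIntegrable_deriv ((ae_restrict_iff' measurableSet_Icc).2 ?_)
    filter_upwards [huac.ae_differentiableAt, hwm.ae_differentiableWithinAt_of_mem, hacc, hγA,
      measure_eq_zero_iff_ae_notMem.1 (measure_singleton (μ := (volume : Measure ℝ)) a),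
      measure_eq_zero_iff_ae_notMem.1 (measure_singleton (μ := (volume : Measure ℝ)) b)]
      with t hdu hdw hacct htA hta htb ht
    have htI : t ∈ Icc a b := hsub ht
    have hto : t ∈ Ioo a b := ⟨lt_of_le_of_ne htI.1 (Ne.symm hta), lt_of_le_of_ne htI.2 htb⟩
    obtain ⟨i, hi⟩ := mem_iUnion.1 (htA htI)
    have hnhds := Icc_mem_nhds hto.1 hto.2
    exact deriv_dist_le_deriv_of_isFirstOrderIsometryOn (hA i) hto (hγc.continuousAt hnhds) hi
      (hacct i hi) hfw ((hdw htI).differentiableAt hnhds)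
      (hdu (by rwa [uIcc_of_le hxy]))
  calc eVariationOn γ (Icc a b) ≤ eVariationOn w (Icc a b) := by
        refine eVariationOn_le_of_edist_le fun x hx y hy hxy => ?_
        rw [edist_dist, edist_dist]
        exact ENNReal.ofReal_le_ofReal ((key x hx y hy hxy).trans (le_abs_self _))
    _ ≤ ENNReal.ofReal (w b - w a) := by
        have := hwm.eVariationOn_eq haI (right_mem_Icc.2 hab)
        rw [inter_self] at this
        exact this.le
    _ = eVariationOn (f ∘ γ) (Icc a b) := by
        rw [hwsub a haI b (right_mem_Icc.2 hab), variationOnFromTo.eq_of_le _ _ hab, inter_self,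
          ENNReal.ofReal_toReal hbv]

/-! ### Arc length parametrization -/

theorem continuousOn_variationOnFromTo {γ : ℝ → X} {s : Set ℝ} (hγ : ContinuousOn γ s)
    (hbv : BoundedVariationOn γ s) {a : ℝ} (ha : a ∈ s) :
    ContinuousOn (variationOnFromTo γ s a) s := by
  intro x hx
  have hl := hbv.locallyBoundedVariationOn
  have h1 := hbv.tendsto_eVariationOn_Icc_zero_left ((hγ x hx).mono inter_subset_left)
  have h2 := hbv.tendsto_eVariationOn_Icc_zero_right x ((hγ x hx).mono inter_subset_left)
  have h3 := (ENNReal.tendsto_toReal ENNReal.zero_ne_top).comp h1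
  have h4 := (ENNReal.tendsto_toReal ENNReal.zero_ne_top).comp h2
  have h5 := h3.add h4
  rw [ENNReal.toReal_zero, add_zero] at h5
  rw [ContinuousWithinAt, tendsto_iff_dist_tendsto_zero]
  refine squeeze_zero' (Eventually.of_forall fun _ => dist_nonneg) ?_ h5
  filter_upwards [self_mem_nhdsWithin] with y hy
  rw [Real.dist_eq, variationOnFromTo.sub_right hl ha hy hx]
  simp only [Function.comp_apply]
  rcases le_total x y with h | h
  · rw [variationOnFromTo.eq_of_le _ _ h, abs_of_nonneg ENNReal.toReal_nonneg]
    linarith [ENNReal.toReal_nonneg (a := eVariationOn γ (s ∩ Icc y x))]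
  · rw [variationOnFromTo.eq_of_ge _ _ h, abs_neg, abs_of_nonneg ENNReal.toReal_nonneg]
    linarith [ENNReal.toReal_nonneg (a := eVariationOn γ (s ∩ Icc x y))]

theorem image_variationOnFromTo_Icc {γ : ℝ → X} (hγ : ContinuousOn γ (Icc 0 1))
    (hfin : curveLength γ ≠ ∞) :
    variationOnFromTo γ (Icc 0 1) 0 '' Icc 0 1 = Icc 0 (curveLength γ).toReal := by
  have hbv : BoundedVariationOn γ (Icc 0 1) := hfin
  have h0 : (0 : ℝ) ∈ Icc (0 : ℝ) 1 := by simp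
  have hvm := variationOnFromTo.monotoneOn hbv.locallyBoundedVariationOn h0
  have hv0 : variationOnFromTo γ (Icc 0 1) 0 0 = 0 := variationOnFromTo.self _ _ _
  have hv1 : variationOnFromTo γ (Icc 0 1) 0 1 = (curveLength γ).toReal := by
    rw [variationOnFromTo.eq_of_le _ _ zero_le_one, inter_self]; rfl
  refine Subset.antisymm ?_ ?_
  · rintro _ ⟨t, ht, rfl⟩
    exact ⟨hv0.symm.le.trans (hvm h0 ht ht.1), (hvm ht (by simp) ht.2).trans hv1.le⟩
  · have h := intermediate_value_Icc zero_le_one (continuousOn_variationOnFromTo hγ hbv h0)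
    rwa [hv0, hv1] at h

theorem lipschitzOnWith_naturalParameterization {γ : ℝ → X} (hγ : ContinuousOn γ (Icc 0 1))
    (hfin : curveLength γ ≠ ∞) :
    LipschitzOnWith 1 (naturalParameterization γ (Icc 0 1) 0) (Icc 0 (curveLength γ).toReal) := by
  have hbv : BoundedVariationOn γ (Icc 0 1) := hfin
  have hunit := has_unit_speed_naturalParameterization γ hbv.locallyBoundedVariationOn
    (show (0 : ℝ) ∈ Icc (0 : ℝ) 1 by simp)
  rw [image_variationOnFromTo_Icc hγ hfin] at hunit
  intro x hx y hy
  wlog hxy : x ≤ y generalizing x y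
  · rw [edist_comm, edist_comm x]; exact this hy hx (le_of_not_ge hxy)
  refine (eVariationOn.edist_le (s := Icc 0 (curveLength γ).toReal ∩ Icc x y) _
    ⟨hx, le_rfl, hxy⟩ ⟨hy, hxy, le_rfl⟩).trans ?_
  rw [hunit hx hy, edist_comm, edist_dist, Real.dist_eq, abs_of_nonneg (sub_nonneg.2 hxy)]
  simp

/-- A rectifiable continuous `γ` need not be absolutely continuous, but its arc length
parametrization is 1-Lipschitz; lengths are unchanged by the monotone reparametrization. -/
theorem curveLength_le_curveLength_comp_of_naturalParameterization {f : X → Y}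
    (hf : LipschitzWith 1 f) {ι : Type*} [Countable ι] {A : ι → Set X}
    (hA : ∀ i, IsFirstOrderIsometryOn f (A i)) {γ : ℝ → X} (hγ : ContinuousOn γ (Icc 0 1))
    (hfin : curveLength γ ≠ ∞)
    (hγA : ∀ᵐ s, s ∈ Icc 0 (curveLength γ).toReal →
      naturalParameterization γ (Icc 0 1) 0 s ∈ ⋃ i, A i) :
    curveLength γ ≤ curveLength (f ∘ γ) := by
  have hbv : BoundedVariationOn γ (Icc 0 1) := hfin
  have hl := hbv.locallyBoundedVariationOn
  have h0 : (0 : ℝ) ∈ Icc (0 : ℝ) 1 := by simp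
  have hvm := variationOnFromTo.monotoneOn hl h0
  have hL0 : 0 ≤ (curveLength γ).toReal := ENNReal.toReal_nonneg
  have hlip := lipschitzOnWith_naturalParameterization hγ hfin
  rw [← uIcc_of_le hL0] at hlip
  have h1 := eVariationOn_le_eVariationOn_comp hf hA hL0 hlip.absolutelyContinuousOnInterval hγA
  have heq : EqOn (naturalParameterization γ (Icc 0 1) 0 ∘ variationOnFromTo γ (Icc 0 1) 0) γ
      (Icc 0 1) := fun t ht =>
    edist_eq_zero.1 (edist_naturalParameterization_eq_zero hl h0 ht)
  rw [← image_variationOnFromTo_Icc hγ hfin, ← eVariationOn.comp_eq_of_monotoneOn _ _ hvm,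
    ← eVariationOn.comp_eq_of_monotoneOn _ _ hvm, eVariationOn.eq_of_eqOn heq,
    Function.comp_assoc, eVariationOn.eq_of_eqOn (heq.comp_left (g := f))] at h1
  exact h1

theorem curveLength_comp_le {f : X → Y} (hf : LipschitzWith 1 f) (γ : ℝ → X) :
    curveLength (f ∘ γ) ≤ curveLength γ := by
  simpa [curveLength] using hf.lipschitzOnWith.comp_eVariationOn_le (mapsTo_univ γ (Icc 0 1))

end

/-! ### Volume preserving maps -/

section
variable {X Y : Type*} [MetricSpace X] [MeasurableSpace X] [BorelSpace X]
  [MetricSpace Y] [MeasurableSpace Y] [BorelSpace Y] {n : ℕ}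

theorem hausdorffMeasure_eq_zero_iff {s : Set X} :
    (μHE[n] : Measure X) s = 0 ↔ μH[n] s = 0 := by
  rw [Measure.euclideanHausdorffMeasure_def, Measure.smul_apply, ENNReal.smul_def, smul_eq_mul,
    mul_eq_zero, or_iff_right]
  simpa using Measure.addHaarScalarFactor_volume_hausdorffMeasure_ne_zero n

theorem hausdorffMeasure_le_hausdorffMeasure_image {f : X → Y}
    (hf : MeasurePreserving f (μHE[n] : Measure X) (μHE[n] : Measure Y)) (A : Set X) :
    μH[n] A ≤ μH[n] (f '' A) := by
  have h : (μHE[n] : Measure X) A ≤ (μHE[n] : Measure Y) (f '' A) := by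
    -- Neither `A` nor its image need be measurable; a measurable hull of `f '' A` is pulled back.
    rw [← measure_toMeasurable (f '' A),
      ← hf.measure_preimage (measurableSet_toMeasurable _ _).nullMeasurableSet]
    exact measure_mono fun x hx => subset_toMeasurable _ _ (mem_image_of_mem f hx)
  rw [Measure.euclideanHausdorffMeasure_def, Measure.euclideanHausdorffMeasure_def,
    Measure.smul_apply, Measure.smul_apply, ENNReal.smul_def, ENNReal.smul_def, smul_eq_mul,
    smul_eq_mul] at h
  refine (ENNReal.mul_le_mul_iff_right ?_ (by simp)).1 h
  simpa using Measure.addHaarScalarFactor_volume_hausdorffMeasure_ne_zero n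

theorem exists_null_isFirstOrderIsometryOn (hX : IsRectifiableSpace n X) {f : X → Y}
    (hf : LipschitzWith 1 f)
    (hvol : MeasurePreserving f (μHE[n] : Measure X) (μHE[n] : Measure Y)) :
    ∃ N : Set X, MeasurableSet N ∧ (μHE[n] : Measure X) N = 0 ∧
      ∃ A : ℕ × ℕ × ℕ → Set X, (∀ i, IsFirstOrderIsometryOn f (A i)) ∧ Nᶜ ⊆ ⋃ i, A i := by
  classical
  rcases isEmpty_or_nonempty X with hXe | ⟨⟨x₀⟩⟩
  · exact ⟨∅, .empty, measure_empty, fun _ => ∅, fun i x hx => hx.elim, fun x => (hXe.false x).elim⟩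
  obtain ⟨E, g, -, hg, h0⟩ := hX
  let G : ℕ → EuclideanSpace ℝ (Fin n) → X := fun i x => if h : x ∈ E i then g i ⟨x, h⟩ else x₀
  have hGE : ∀ i, G i '' E i = range (g i) := by
    intro i
    ext y
    constructor
    · rintro ⟨x, hx, rfl⟩
      exact ⟨⟨x, hx⟩, by simp [G, hx]⟩
    · rintro ⟨x, rfl⟩
      exact ⟨x, x.2, by simp [G]⟩
  have hG : ∀ i, ∃ A : ℕ × ℕ → Set X, (∀ j, IsFirstOrderIsometryOn f (A j)) ∧
      μH[n] (G i '' E i \ ⋃ j, A j) = 0 := by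
    intro i
    obtain ⟨L, hL⟩ := hg i
    refine exists_isFirstOrderIsometryOn_chart hf
      (hausdorffMeasure_le_hausdorffMeasure_image hvol) (C := L) fun x hx y hy => ?_
    simpa [G, hx, hy] using hL ⟨x, hx⟩ ⟨y, hy⟩
  choose A hA hA0 using hG
  have hnull : (μHE[n] : Measure X) (⋃ i : ℕ × ℕ × ℕ, A i.1 i.2)ᶜ = 0 := by
    refine measure_mono_null (t := (⋃ i, range (g i))ᶜ ∪ ⋃ i, G i '' E i \ ⋃ j, A i j) ?_
      (measure_union_null h0 (measure_iUnion_null fun i => hausdorffMeasure_eq_zero_iff.2 (hA0 i)))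
    intro x hx
    by_cases hxr : x ∈ ⋃ i, range (g i)
    · obtain ⟨i, hi⟩ := mem_iUnion.1 hxr
      refine Or.inr (mem_iUnion.2 ⟨i, by rwa [hGE], fun hxA => hx ?_⟩)
      obtain ⟨j, hj⟩ := mem_iUnion.1 hxA
      exact mem_iUnion.2 ⟨(i, j), hj⟩
    · exact Or.inl hxr
  refine ⟨toMeasurable _ (⋃ i : ℕ × ℕ × ℕ, A i.1 i.2)ᶜ, measurableSet_toMeasurable _ _,
    by rw [measure_toMeasurable, hnull], fun i => A i.1 i.2, fun i => hA _ _, ?_⟩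
  rw [compl_subset_comm]
  exact subset_toMeasurable _ _

/-- As `f` maps `f ⁻¹' B` onto `B` without increasing measure, the pushforward dominates the measure
of `Y`; equal finite total masses leave no room for strict inequality. -/
theorem measurePreserving_of_surjective {f : X → Y} (hf : LipschitzWith 1 f)
    (hsurj : Function.Surjective f) (h : (μHE[n] : Measure X) univ = (μHE[n] : Measure Y) univ)
    (hfin : (μHE[n] : Measure X) univ < ∞) :
    MeasurePreserving f (μHE[n] : Measure X) (μHE[n] : Measure Y) := by
  have hm : Measurable f := hf.continuous.measurable
  have : IsFiniteMeasure (μHE[n] : Measure Y) := ⟨h ▸ hfin⟩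
  refine ⟨hm, (Measure.eq_of_le_of_measure_univ_eq ?_ ?_).symm⟩
  · refine Measure.le_iff.2 fun B hB => ?_
    rw [Measure.map_apply hm hB, Measure.euclideanHausdorffMeasure_def,
      Measure.euclideanHausdorffMeasure_def, Measure.smul_apply, Measure.smul_apply]
    have h1 := hf.hausdorffMeasure_image_le (Nat.cast_nonneg n) (f ⁻¹' B)
    rw [image_preimage_eq B hsurj, ENNReal.coe_one, ENNReal.one_rpow, one_mul] at h1
    gcongr
  · rw [Measure.map_apply hm .univ, preimage_univ, h]

/-- The density `∞ · 1_N` has essential supremum 0. Its integral is `∞` over nonrectifiable curves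
by convention, and a value below 1 over a rectifiable curve forces almost every arc length time to
avoid `N`. -/
theorem forTopAlmostEveryCurve_of_null {μ : Measure X} {N : Set X} (hN : MeasurableSet N)
    (hN0 : μ N = 0) {P : (ℝ → X) → Prop}
    (h : ∀ γ : ℝ → X, ContinuousOn γ (Icc 0 1) → curveLength γ ≠ ∞ →
      (∀ᵐ s, s ∈ Icc 0 (curveLength γ).toReal → naturalParameterization γ (Icc 0 1) 0 s ∉ N) →
      P γ) : ForTopAlmostEveryCurve μ P := by
  rw [ForTopAlmostEveryCurve, modulusTop, ← nonpos_iff_eq_zero]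
  refine iInf₂_le_of_le (N.indicator fun _ => ∞) (measurable_const.indicator hN)
    (iInf_le_of_le (fun γ hγ => ?_) ?_)
  · rw [lineIntegral]
    split_ifs with hfin
    · simp
    by_contra hlt
    refine hγ.2 (h γ hγ.1 hfin ?_)
    have hσ : AEMeasurable (naturalParameterization γ (Icc 0 1) 0)
        (volume.restrict (Icc 0 (curveLength γ).toReal)) :=
      (lipschitzOnWith_naturalParameterization hγ.1 hfin).continuousOn.aemeasurable
        measurableSet_Icc
    have hlt := ae_lt_top' ((measurable_const.indicator hN).comp_aemeasurable hσ)
      ((not_le.1 hlt).trans_le le_top).ne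
    filter_upwards [(ae_restrict_iff' measurableSet_Icc).1 hlt] with s hs hsI hsN
    simpa [hsN] using hs hsI
  · refine essSup_le_of_ae_le _ ?_
    filter_upwards [measure_eq_zero_iff_ae_notMem.1 hN0] with x hx
    exact (indicator_of_notMem hx _).le

end

end VolumeRigidity

theorem mainTheorem8 (n : ℕ) {X Y : Type*}
    [MetricSpace X] [MeasurableSpace X] [BorelSpace X]
    [MetricSpace Y] [MeasurableSpace Y] [BorelSpace Y]
    (hX : VolumeRigidity.IsRectifiableSpace n X) (hY : VolumeRigidity.IsRectifiableSpace n Y)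
    (f : X → Y) (hf : LipschitzWith 1 f) :
    (MeasurePreserving f (μHE[n] : Measure X) (μHE[n] : Measure Y) →
      ∃ N : Set X, MeasurableSet N ∧ (μHE[n] : Measure X) N = 0 ∧
        ∀ γ : ℝ → X, AbsolutelyContinuousOnInterval γ 0 1 →
          volume (Icc (0 : ℝ) 1 ∩ γ ⁻¹' N) = 0 →
            VolumeRigidity.curveLength γ = VolumeRigidity.curveLength (f ∘ γ)) ∧
    (Function.Surjective f →
      (μHE[n] : Measure X) univ = (μHE[n] : Measure Y) univ →
      (μHE[n] : Measure X) univ < ∞ →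
        MeasurePreserving f (μHE[n] : Measure X) (μHE[n] : Measure Y) ∧
        VolumeRigidity.ForTopAlmostEveryCurve (μHE[n] : Measure X)
          (fun γ => VolumeRigidity.curveLength (f ∘ γ) = VolumeRigidity.curveLength γ)) := by
  refine ⟨fun hvol => ?_, fun hsurj huniv hfin => ?_⟩
  · obtain ⟨N, hN, hN0, A, hA, hNA⟩ :=
      VolumeRigidity.exists_null_isFirstOrderIsometryOn hX hf hvol
    refine ⟨N, hN, hN0, fun γ hγ hγN => le_antisymm ?_ (VolumeRigidity.curveLength_comp_le hf γ)⟩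
    refine VolumeRigidity.eVariationOn_le_eVariationOn_comp hf hA zero_le_one hγ ?_
    filter_upwards [measure_eq_zero_iff_ae_notMem.1 hγN] with t ht htI
    exact hNA fun h => ht ⟨htI, h⟩
  · have hvol := VolumeRigidity.measurePreserving_of_surjective hf hsurj huniv hfin
    obtain ⟨N, hN, hN0, A, hA, hNA⟩ :=
      VolumeRigidity.exists_null_isFirstOrderIsometryOn hX hf hvol
    refine ⟨hvol, VolumeRigidity.forTopAlmostEveryCurve_of_null hN hN0 fun γ hγ hγfin hγN =>
      le_antisymm (VolumeRigidity.curveLength_comp_le hf γ) ?_⟩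
    refine VolumeRigidity.curveLength_le_curveLength_comp_of_naturalParameterization hf hA hγ
      hγfin ?_
    filter_upwards [hγN] with s hs hsI using hNA (hs hsI)
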